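/- Let $K$ be a local field, i.e. the field of fractions of a complete discrete valuation ring $\mathcal{O}_K$ whose residue field is perfect of characteristic $p>0$, and let $L/K$ be a finite Galois extension with Galois group $G$. Let $\mathcal{O}_L$ be the integral closure of $\mathcal{O}_K$ in $L$ (again a complete discrete valuation ring), let $\mathfrak{m}_L$ be its maximal ideal, and for $s\ge 0$ let $$G_s=\{\sigma\in G : \sigma(x)-x\in \mathfrak{m}_L^{s+1}\text{ for all }x\in\mathcal{O}_L\}$$ be the $s$-th ramification group (in lower numbering). Let $b\in\mathbb{Z}$. Then the fractional ideal $\mathfrak{m}_L^b$ of $L$, with the natural action of $G$, is a free module over the group ring $\mathcal{O}_K[G]$ if and only if $L/K$ is weakly ramified (that is, $G_2$ is trivial) and $b\equiv 1 \pmod{|G_1|}$. -/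

import Mathlib

open scoped nonZeroDivisors Pointwise MonoidAlgebra

/-! ### The ring of integers of a finite Galois extension of a complete discretely valued field -/

section Locality

open Polynomial

/-- If a finite group `G` acts on a domain `B` with invariants a complete local ring `A`,
then `B` is local. -/
theorem isLocalRing_of_isInvariant (A B G : Type*) [CommRing A] [IsLocalRing A]
    [IsAdicComplete (IsLocalRing.maximalIdeal A) A] [CommRing B] [IsDomain B] [Algebra A B]
    [Group G] [Finite G] [MulSemiringAction G B] [SMulCommClass G A B]
    [Algebra.IsInvariant A B G] : IsLocalRing B := by
  classical
  have := Fintype.ofFinite G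
  have hint : Algebra.IsIntegral A B := Algebra.IsInvariant.isIntegral A B G
  have hunder : ∀ P : Ideal B, P.IsMaximal → P.under A = IsLocalRing.maximalIdeal A := by
    intro P hP
    exact IsLocalRing.eq_maximalIdeal (Ideal.isMaximal_comap_of_isIntegral_of_isMaximal P)
  obtain ⟨Q, hQ⟩ := Ideal.exists_maximal B
  refine IsLocalRing.of_unique_max_ideal ⟨Q, hQ, fun P hP => ?_⟩
  by_contra hPQ
  have memQ : ∀ a : A, algebraMap A B a ∈ Q ↔ a ∈ IsLocalRing.maximalIdeal A := by
    intro a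
    rw [← hunder Q hQ]; rfl
  have memP : ∀ a : A, algebraMap A B a ∈ P ↔ a ∈ IsLocalRing.maximalIdeal A := by
    intro a
    rw [← hunder P hP]; rfl
  have hmax : ∀ g : G, (g • Q).IsPrime := fun g => hQ.isPrime.smul g
  obtain ⟨g₀, hg₀⟩ := Algebra.IsInvariant.exists_smul_of_under_eq A B G Q P
    ((hunder Q hQ).trans (hunder P hP).symm)
  have smulmem : ∀ (g : G) (x : B), x ∈ g • Q ↔ g⁻¹ • x ∈ Q := fun g x =>
    Ideal.mem_pointwise_smul_iff_inv_smul_mem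
  -- an element that is `1` mod `Q` and `0` mod all the other conjugates of `Q`
  obtain ⟨x, hxQ, hxo⟩ : ∃ x : B, x - 1 ∈ Q ∧ ∀ g : G, g • Q ≠ Q → x ∈ g • Q := by
    have h1 : ¬ (Finset.univ.filter (fun g : G => g • Q ≠ Q)).inf (fun g => g • Q) ≤ Q := by
      rw [Ideal.IsPrime.inf_le' hQ.isPrime]
      rintro ⟨g, hg1, hg2⟩
      exact (Finset.mem_filter.mp hg1).2 (smul_eq_of_smul_le hg2)
    obtain ⟨b, hb, hbQ⟩ := SetLike.not_le_iff_exists.mp h1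
    obtain ⟨c, hc⟩ := hQ.exists_inv hbQ
    obtain ⟨q, hq, hcq⟩ := hc
    refine ⟨c * b, ?_, fun g hg => Ideal.mul_mem_left _ _ ?_⟩
    · have : c * b - 1 = -q := by rw [← hcq]; ring
      rw [this]; exact Q.neg_mem hq
    · have hle : (Finset.univ.filter (fun g : G => g • Q ≠ Q)).inf (fun g => g • Q) ≤ g • Q :=
        Finset.inf_le (f := fun g : G => g • Q) (Finset.mem_filter.mpr ⟨Finset.mem_univ g, hg⟩)
      exact hle hb
  let D := MulAction.stabilizer G Q
  let y : B := ∏ d : D, (d : G) • x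
  have hyQ : y - 1 ∈ Q := by
    rw [← Ideal.Quotient.eq] at hxQ ⊢
    simp only [y, map_prod, map_one]
    refine Finset.prod_eq_one fun d _ => ?_
    rw [← map_one (Ideal.Quotient.mk Q), Ideal.Quotient.eq]
    have hd : (d : G) • Q = Q := d.2
    have h2 : (d : G) • (x - 1) ∈ (d : G) • Q := Ideal.smul_mem_pointwise_smul _ _ _
      ((Ideal.Quotient.eq).1 (by simpa using hxQ))
    rw [hd, smul_sub, smul_one] at h2
    exact h2
  have hyo : ∀ g : G, g • Q ≠ Q → y ∈ g • Q := by
    intro g hg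
    have : x ∈ g • Q := hxo g hg
    refine Ideal.mem_of_dvd _ (Finset.dvd_prod_of_mem _ (Finset.mem_univ (1 : D))) ?_
    simpa using this
  have hyD : ∀ d ∈ D, d • y = y := by
    intro d hd
    simp only [y, Finset.smul_prod']
    refine Fintype.prod_bijective (fun e : D => (⟨d, hd⟩ : D) * e)
      (Group.mulLeft_bijective _) _ _ fun e => ?_
    simp [mul_smul]
  have hynQ : y ∉ Q := fun h => hQ.ne_top ((Ideal.eq_top_iff_one _).2 (by
    have := Q.sub_mem h hyQ; simpa using this))
  have conj : ∀ g : G, g • y ≠ y → g • y ∈ Q := by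
    intro g hg
    have h1 : g⁻¹ • Q ≠ Q := fun h => hg (hyD g (by
      have : g⁻¹ ∈ D := h
      simpa using D.inv_mem this))
    have h2 := hyo _ h1
    rwa [smulmem, inv_inv] at h2
  -- the polynomial of the distinct conjugates of `y`
  let f : B[X] := prodXSubSMul G B y
  have hf : f.Monic := prodXSubSMul.monic G B y
  have hlift : f ∈ Polynomial.lifts (algebraMap A B) :=
    (f.lifts_iff_coeff_lifts).mpr fun n =>
      Algebra.IsInvariant.isInvariant (A := A) (G := G) _ fun g => prodXSubSMul.coeff G B y g n
  obtain ⟨p, hp, -, hpm⟩ := Polynomial.lifts_and_natDegree_eq_and_monic hlift hf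
  let c₀ : G ⧸ MulAction.stabilizer G y := QuotientGroup.mk 1
  let h : B[X] := ∏ c ∈ Finset.univ.erase c₀,
    (X - C (MulAction.ofQuotientStabilizer G y c))
  have hfac : f = (X - C y) * h := by
    have h0 : MulAction.ofQuotientStabilizer G y c₀ = y := by simp [c₀]
    have h1 : f = ∏ c, (X - C (MulAction.ofQuotientStabilizer G y c)) := by
      simp only [f, prodXSubSMul]
    rw [h1, ← Finset.mul_prod_erase _ _ (Finset.mem_univ c₀), h0]
  have hh : h.eval 1 ∉ Q := by
    simp only [h, eval_prod, eval_sub, eval_X, eval_C]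
    rw [hQ.isPrime.prod_mem_iff]
    rintro ⟨c, hc, hcQ⟩
    induction c using QuotientGroup.induction_on with
    | H g =>
      rw [MulAction.ofQuotientStabilizer_mk] at hcQ
      have hne : g • y ≠ y := by
        intro hg
        refine (Finset.mem_erase.1 hc).1 ?_
        refine (QuotientGroup.eq.2 ?_)
        simpa using hg
      have := Q.add_mem hcQ (conj g hne)
      exact hQ.ne_top ((Ideal.eq_top_iff_one _).2 (by simpa using this))
  have e1 : f.eval 1 ∈ Q := by
    rw [hfac, eval_mul]
    refine Ideal.mul_mem_right _ _ ?_
    have := Q.neg_mem hyQ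
    simpa using this
  have e2 : (derivative f).eval 1 ∉ Q := by
    rw [hfac, derivative_mul]
    simp only [derivative_sub, derivative_X, derivative_C, sub_zero, one_mul, eval_add, eval_mul,
      eval_sub, eval_X, eval_C]
    intro hmem
    have h3 : (1 - y) * eval 1 (derivative h) ∈ Q := by
      refine Ideal.mul_mem_right _ _ ?_
      have := Q.neg_mem hyQ
      simpa using this
    exact hh (by simpa using Q.sub_mem hmem h3)
  have p1 : p.eval 1 ∈ IsLocalRing.maximalIdeal A := by
    have : algebraMap A B (p.eval 1) = f.eval 1 := by
      rw [← hp, eval_map, eval₂_at_one]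
    rw [← memQ, this]; exact e1
  have p2 : IsUnit (p.derivative.eval 1) := by
    rw [← IsLocalRing.notMem_maximalIdeal, ← memQ]
    have : algebraMap A B (p.derivative.eval 1) = (derivative f).eval 1 := by
      rw [← hp, derivative_map, eval_map, eval₂_at_one]
    rw [this]; exact e2
  obtain ⟨a, ha, -⟩ := HenselianRing.is_henselian (I := IsLocalRing.maximalIdeal A) p hpm 1 p1
    (p2.map (Ideal.Quotient.mk _))
  have hroot : f.eval (algebraMap A B a) = 0 := by
    rw [← hp, eval_map, eval₂_at_apply, ha.eq_zero, map_zero]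
  have : ∃ g : G, algebraMap A B a = g • y := by
    simp only [f, prodXSubSMul, eval_prod, Finset.prod_eq_zero_iff] at hroot
    obtain ⟨c, -, hc⟩ := hroot
    induction c using QuotientGroup.induction_on with
    | H g => exact ⟨g, by simpa [sub_eq_zero] using hc⟩
  obtain ⟨g, hg⟩ := this
  have hya : y = algebraMap A B a := by
    have : g⁻¹ • algebraMap A B a = algebraMap A B a := smul_algebraMap _ _
    rw [← this, hg, inv_smul_smul]
  have hyP : y ∈ P := by
    rw [hg₀]
    exact hyo g₀ (fun h => hPQ (hg₀.trans h))
  rw [hya, memP, ← memQ, ← hya] at hyP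
  exact hynQ hyP

end Locality

section LocalFields

open IsLocalRing

instance galSMulCommClass {A K L : Type*} [CommSemiring A] [Field K] [Algebra A K]
    [Field L] [Algebra K L] [Algebra A L] [IsScalarTower A K L] :
    SMulCommClass (L ≃ₐ[K] L) A L where
  smul_comm g a x := by
    rw [← algebraMap_smul K a x, ← algebraMap_smul K a (g • x), smul_comm]

theorem isInvariant_integralClosure (A K L : Type*) [CommRing A] [IsDomain A]
    [IsIntegrallyClosed A] [Field K] [Algebra A K] [IsFractionRing A K]
    [Field L] [Algebra K L] [Algebra A L] [IsScalarTower A K L]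
    [FiniteDimensional K L] [IsGalois K L] :
    Algebra.IsInvariant A (integralClosure A L) (L ≃ₐ[K] L) := by
  refine ⟨fun b hb => ?_⟩
  have h1 : ∀ g : L ≃ₐ[K] L, g (b : L) = b := fun g => congrArg Subtype.val (hb g)
  obtain ⟨k, hk⟩ := (IsGalois.mem_range_algebraMap_iff_fixed (F := K) (b : L)).2 h1
  have hb' : IsIntegral A (algebraMap K L k) := hk ▸ b.2
  rw [isIntegral_algebraMap_iff (FaithfulSMul.algebraMap_injective K L)] at hb'
  obtain ⟨a, rfl⟩ := IsIntegrallyClosed.algebraMap_eq_of_integral hb'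
  refine ⟨a, Subtype.ext ?_⟩
  rw [← hk, ← IsScalarTower.algebraMap_apply]
  rfl

variable (A K L : Type*) [CommRing A] [IsDomain A] [IsDiscreteValuationRing A]
  [IsAdicComplete (maximalIdeal A) A] [Field K] [Algebra A K] [IsFractionRing A K]
  [Field L] [Algebra K L] [Algebra A L] [IsScalarTower A K L]
  [FiniteDimensional K L] [IsGalois K L]

theorem isLocalRing_integralClosure (A K L : Type*) [CommRing A] [IsDomain A]
    [IsDiscreteValuationRing A] [IsAdicComplete (maximalIdeal A) A] [Field K] [Algebra A K]
    [IsFractionRing A K] [Field L] [Algebra K L] [Algebra A L] [IsScalarTower A K L]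
    [FiniteDimensional K L] [IsGalois K L] : IsLocalRing (integralClosure A L) :=
  have := isInvariant_integralClosure A K L
  isLocalRing_of_isInvariant A (integralClosure A L) (L ≃ₐ[K] L)

/-- The maximal ideal `𝔪_L` of the ring of integers `𝒪_L`, the integral closure of `A = 𝒪_K`
in `L`. -/
noncomputable def maximalIdealIntegers : Ideal (integralClosure A L) :=
  haveI := isLocalRing_integralClosure A K L
  maximalIdeal (integralClosure A L)

/-- The ramification group `G_s` (lower numbering): all `σ ∈ G = Gal(L/K)` with
`σ x - x ∈ 𝔪_L ^ (s + 1)` for all `x ∈ 𝒪_L`. -/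
noncomputable def ramificationGroup (s : ℕ) : Subgroup (L ≃ₐ[K] L) :=
  (maximalIdealIntegers A K L ^ (s + 1)).inertia (L ≃ₐ[K] L)

/-- `L/K` is weakly ramified: the second ramification group is trivial. -/
def IsWeaklyRamified : Prop := ramificationGroup A K L 2 = ⊥

/-- The fractional ideal `𝔪_L ^ b` of `L`, `b ∈ ℤ`. -/
noncomputable def fractionalIdealPow (b : ℤ) :
    FractionalIdeal (integralClosure A L)⁰ L :=
  haveI := integralClosure.isDedekindDomain A K L
  haveI : IsFractionRing (integralClosure A L) L :=
    integralClosure.isFractionRing_of_finite_extension K L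
  (maximalIdealIntegers A K L : FractionalIdeal (integralClosure A L)⁰ L) ^ b

theorem smul_mem_maximalIdealIntegers_pow (g : L ≃ₐ[K] L) (n : ℕ) {x : integralClosure A L}
    (hx : x ∈ maximalIdealIntegers A K L ^ n) : g • x ∈ maximalIdealIntegers A K L ^ n := by
  have hloc := isLocalRing_integralClosure A K L
  have h1 : g • maximalIdealIntegers A K L = maximalIdealIntegers A K L := by
    have hm : (maximalIdealIntegers A K L).IsMaximal := maximalIdeal.isMaximal _
    have h2 : (g • maximalIdealIntegers A K L).IsPrime := hm.isPrime.smul g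
    exact smul_eq_of_smul_le (le_maximalIdeal h2.ne_top)
  have h3 : g • (maximalIdealIntegers A K L ^ n) = maximalIdealIntegers A K L ^ n := by
    rw [smul_pow', h1]
  rw [← h3]
  exact Ideal.smul_mem_pointwise_smul _ _ _ hx

theorem apply_mem_fractionalIdealPow (g : L ≃ₐ[K] L) (b : ℤ) {x : L}
    (hx : x ∈ fractionalIdealPow A K L b) : g x ∈ fractionalIdealPow A K L b := by
  have hD := integralClosure.isDedekindDomain A K L
  have hF : IsFractionRing (integralClosure A L) L :=
    integralClosure.isFractionRing_of_finite_extension K L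
  have hnat : ∀ (h : L ≃ₐ[K] L) (n : ℕ) (y : L),
      y ∈ (maximalIdealIntegers A K L : FractionalIdeal (integralClosure A L)⁰ L) ^ n →
      h y ∈ (maximalIdealIntegers A K L : FractionalIdeal (integralClosure A L)⁰ L) ^ n := by
    intro h n y hy
    rw [← FractionalIdeal.coeIdeal_pow, FractionalIdeal.mem_coeIdeal] at hy ⊢
    obtain ⟨z, hz, rfl⟩ := hy
    exact ⟨h • z, smul_mem_maximalIdealIntegers_pow A K L h n hz, rfl⟩
  unfold fractionalIdealPow at hx ⊢
  by_cases h0 : maximalIdealIntegers A K L = ⊥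
  · rw [h0, FractionalIdeal.coeIdeal_bot] at hx ⊢
    rcases eq_or_ne b 0 with rfl | hb
    · rw [zpow_zero, FractionalIdeal.mem_one_iff] at hx ⊢
      obtain ⟨z, rfl⟩ := hx
      exact ⟨g • z, rfl⟩
    · rw [zero_zpow _ hb, FractionalIdeal.mem_zero_iff] at hx ⊢
      rw [hx, map_zero]
  obtain ⟨n, rfl | rfl⟩ := b.eq_nat_or_neg
  · rw [zpow_natCast] at hx ⊢
    exact hnat g n x hx
  · rw [zpow_neg, zpow_natCast] at hx ⊢
    have hne : (maximalIdealIntegers A K L : FractionalIdeal (integralClosure A L)⁰ L) ^ n ≠ 0 :=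
      pow_ne_zero _ (FractionalIdeal.coeIdeal_ne_zero.2 h0)
    rw [FractionalIdeal.mem_inv_iff hne] at hx ⊢
    intro y hy
    have h1 := hx _ (hnat g⁻¹ n y hy)
    rw [FractionalIdeal.mem_one_iff] at h1 ⊢
    obtain ⟨z, hz⟩ := h1
    refine ⟨g • z, ?_⟩
    have h2 : g (algebraMap (integralClosure A L) L z) = g (x * g⁻¹ y) := congrArg g hz
    have h3 : g (g⁻¹ y) = y := g.apply_symm_apply y
    rw [map_mul, h3] at h2
    exact h2

/-- The fractional ideal `𝔪_L ^ b` as an `A`-linear representation of `G`, acting through its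
natural action on `L`. The corresponding module over the group ring `A[G]` is
`(fractionalIdealRep A K L b).asModule`. -/
noncomputable def fractionalIdealRep (b : ℤ) :
    Representation A (L ≃ₐ[K] L)
      ((fractionalIdealPow A K L b : Submodule (integralClosure A L) L).restrictScalars A) :=
  Subrepresentation.toRepresentation (ρ := Representation.ofDistribMulAction A (L ≃ₐ[K] L) L)
    { toSubmodule :=
        (fractionalIdealPow A K L b : Submodule (integralClosure A L) L).restrictScalars A
      apply_mem_toSubmodule := fun g _ hv => apply_mem_fractionalIdealPow A K L g b hv }

end LocalFields

set_option linter.unusedSectionVars false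

/-! Write `B = 𝒪_L` with uniformizer `Π` and valuation `v`, `H = G_1`, `h = |H|`, and `δ = ∏ (Π -
σΠ)` over `σ ≠ 1` in `H`. Since the residue field is perfect, inertia subgroups are totally
ramified: valuations of `H`-fixed elements are multiples of `h`. Hence every `x ∈ L` has an
expansion `∑ c_i Π^i`, `i < h`, with fixed `c_i`, whose nonzero terms have distinct valuations.
Euler's formula says that `tr_H y` is the top coefficient of the expansion of `yδ`, so `v(tr_H y) +
h - 1 ≥ v(y) + v(δ)` (`trace_mul_pow_mem`). Both directions rest on this estimate.

Free implies weakly ramified: in a free module over the group ring every `H`-fixed element is an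
`H`-trace. Apply this to a fixed element whose valuation is the least multiple of `h` that is at
least `b`. As `v(δ) ≥ 2(h - 1)`, the estimate leaves no slack, which forces `v(Π - σΠ) = 2` for all
`σ ≠ 1` in `H` and `b ≡ 1` modulo `h` (`ord_sub_eq_two_and_modEq_of_trace_surjective`).

Conversely, let `k` and `l` be the residue fields of `K` and `L`, and `V = 𝔪_L^b / 𝔪_K 𝔪_L^b`. By
Nakayama's lemma and equality of ranks it suffices that `V` is cyclic over `k[G]`, and for this that
`dim Hom(V, E) ≤ dim E` for every simple `E` (`exists_span_singleton_eq_top_of_finrank_hom_le`).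
Filter `Hom(V, E)` by vanishing on `𝔪_L^i`. The normal `p`-subgroup `H` acts trivially on `E`, and
modulo the augmentation of `H` an element of `𝔪_L^i` can be pushed into `𝔪_L^(i+1)` unless `i ≡ b`
modulo `h` (`exists_eq_sum_smul_of_weaklyRamified`). So only the steps `i = b + hj` with `0 ≤ j <
e/h` contribute, where `e` is the ramification index.

Step `i` contributes a `k`-subspace of `Hom_k(l, E)`, an `l`-space of dimension `dim_k E`. Its
vectors are fixed by semilinear lifts of `Gal(l/k)`, so by Galois descent its `k`-dimension is at
most that of its `l`-span. A generator of tame inertia acts on it by `ζ^i`, where `ζ` has order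
`e/h` prime to `p`. These eigenvalues differ for different `j`, so the contributions add up to at
most `dim_k E` (`IsEquivariantEval.finrank_le`). -/

namespace DVRExtension

/-! ### Valuation and powers of the maximal ideal -/

section Ord

variable (B L : Type*) [CommRing B] [IsDomain B] [IsDiscreteValuationRing B] [Field L]
  [Algebra B L] [IsFractionRing B L]

/-- A chosen uniformizer of the discrete valuation ring `B`. -/
noncomputable def unif : B := (IsDiscreteValuationRing.exists_irreducible B).choose

theorem irreducible_unif : Irreducible (unif B) :=
  (IsDiscreteValuationRing.exists_irreducible B).choose_spec

/-- The chosen uniformizer of `B` as an element of the fraction field `L`. -/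
noncomputable def unifL : L := algebraMap B L (unif B)

theorem unifL_ne_zero : unifL B L ≠ 0 := by
  rw [unifL, Ne, IsFractionRing.to_map_eq_zero_iff]
  exact (irreducible_unif B).ne_zero

/-- The `n`-th power of the maximal ideal of `B`, as a `B`-submodule of `L`. -/
noncomputable def powSubmodule (n : ℤ) : Submodule B L :=
  (LinearMap.toSpanSingleton B L (unifL B L ^ n)).range

variable {B L}

theorem mem_powSubmodule {n : ℤ} {x : L} :
    x ∈ powSubmodule B L n ↔ ∃ y : B, x = algebraMap B L y * unifL B L ^ n := by
  simp [powSubmodule, LinearMap.mem_range, Algebra.smul_def, eq_comm]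

theorem exists_unit_mul_zpow {x : L} (hx : x ≠ 0) :
    ∃ (n : ℤ) (u : Bˣ), x = algebraMap B L u * unifL B L ^ n := by
  obtain ⟨a, s, hs, rfl⟩ := IsFractionRing.div_surjective B x
  have hs0 : s ≠ 0 := nonZeroDivisors.ne_zero hs
  have ha0 : a ≠ 0 := by rintro rfl; simp at hx
  obtain ⟨m, u, hu⟩ := IsDiscreteValuationRing.eq_unit_mul_pow_irreducible ha0 (irreducible_unif B)
  obtain ⟨n, w, hw⟩ := IsDiscreteValuationRing.eq_unit_mul_pow_irreducible hs0 (irreducible_unif B)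
  refine ⟨m - n, u * w⁻¹, ?_⟩
  have hw0 : algebraMap B L (w : B) ≠ 0 := by simp
  have h1 : algebraMap B L ((w⁻¹ : Bˣ) : B) = (algebraMap B L (w : B))⁻¹ := by
    rw [← mul_left_inj' hw0, inv_mul_cancel₀ hw0, ← map_mul]; simp
  have hp := unifL_ne_zero B L
  rw [hu, hw, zpow_sub₀ hp, Units.val_mul]
  simp only [map_mul, map_pow, h1, zpow_natCast]
  change _ * unifL B L ^ m / (_ * unifL B L ^ n) = _
  field_simp

open scoped Classical in
variable (B) in
/-- The normalized valuation of `x : L`; it takes the value `0` at `x = 0`. -/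
noncomputable def ord (x : L) : ℤ :=
  if hx : x = 0 then 0 else (exists_unit_mul_zpow (B := B) hx).choose

theorem exists_unit_mul_zpow_ord {x : L} (hx : x ≠ 0) :
    ∃ u : Bˣ, x = algebraMap B L u * unifL B L ^ ord B x := by
  rw [ord, dif_neg hx]
  exact (exists_unit_mul_zpow (B := B) hx).choose_spec

theorem zpow_mem_powSubmodule_iff {m n : ℤ} {u : Bˣ} :
    algebraMap B L u * unifL B L ^ m ∈ powSubmodule B L n ↔ n ≤ m := by
  have hp := unifL_ne_zero B L
  rw [mem_powSubmodule]
  constructor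
  · rintro ⟨y, hy⟩
    by_contra! hlt
    obtain ⟨k, hk⟩ : ∃ k : ℕ, n = m + k + 1 := ⟨(n - m - 1).toNat, by omega⟩
    have h1 : algebraMap B L u = algebraMap B L (y * unif B ^ (k + 1)) := by
      have h2 : unifL B L ^ n = unifL B L ^ m * unifL B L ^ (k + 1) := by
        rw [hk, add_assoc, zpow_add₀ hp]; norm_cast
      rw [h2] at hy
      have h3 : unifL B L ^ m ≠ 0 := zpow_ne_zero _ hp
      apply mul_right_cancel₀ h3
      rw [hy, map_mul, map_pow, ← unifL]; ring
    have h2 := IsFractionRing.injective B L h1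
    have h3 : IsUnit (y * unif B ^ (k + 1)) := h2 ▸ u.isUnit
    rw [pow_succ] at h3
    exact (irreducible_unif B).not_isUnit
      (isUnit_of_mul_isUnit_right (isUnit_of_mul_isUnit_right h3))
  · intro h
    obtain ⟨k, rfl⟩ : ∃ k : ℕ, m = n + k := ⟨(m - n).toNat, by omega⟩
    refine ⟨u * unif B ^ k, ?_⟩
    rw [zpow_add₀ hp, map_mul, map_pow, ← unifL, zpow_natCast]; ring

theorem mem_powSubmodule_iff_ord {n : ℤ} {x : L} (hx : x ≠ 0) :
    x ∈ powSubmodule B L n ↔ n ≤ ord B x := by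
  obtain ⟨u, hu⟩ := exists_unit_mul_zpow_ord (B := B) hx
  conv_lhs => rw [hu]
  exact zpow_mem_powSubmodule_iff

theorem ord_eq_iff {n : ℤ} {x : L} (hx : x ≠ 0) :
    ord B x = n ↔ x ∈ powSubmodule B L n ∧ x ∉ powSubmodule B L (n + 1) := by
  rw [mem_powSubmodule_iff_ord hx, mem_powSubmodule_iff_ord hx]; omega

theorem ord_unit_mul_zpow (u : Bˣ) (n : ℤ) : ord B (algebraMap B L u * unifL B L ^ n) = n := by
  rw [ord_eq_iff, zpow_mem_powSubmodule_iff, zpow_mem_powSubmodule_iff]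
  · omega
  · exact mul_ne_zero (by simp) (zpow_ne_zero _ (unifL_ne_zero B L))

theorem ord_mul {x y : L} (hx : x ≠ 0) (hy : y ≠ 0) : ord B (x * y) = ord B x + ord B y := by
  obtain ⟨u, hu⟩ := exists_unit_mul_zpow_ord (B := B) hx
  obtain ⟨w, hw⟩ := exists_unit_mul_zpow_ord (B := B) hy
  have : x * y = algebraMap B L (u * w : Bˣ) * unifL B L ^ (ord B x + ord B y) := by
    rw [zpow_add₀ (unifL_ne_zero B L), Units.val_mul, map_mul]
    nth_rw 1 [hu, hw]; ring
  rw [this, ord_unit_mul_zpow]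

theorem ord_one : ord B (1 : L) = 0 := by
  simpa using ord_unit_mul_zpow (B := B) (L := L) 1 0

theorem ord_unifL_zpow (n : ℤ) : ord B (unifL B L ^ n) = n := by
  simpa using ord_unit_mul_zpow (B := B) (L := L) 1 n

theorem ord_unifL : ord B (unifL B L) = 1 := by
  simpa using ord_unifL_zpow (B := B) (L := L) 1

theorem ord_inv {x : L} (hx : x ≠ 0) : ord B x⁻¹ = - ord B x := by
  have := ord_mul (B := B) hx (inv_ne_zero hx)
  rw [mul_inv_cancel₀ hx, ord_one] at this
  omega

theorem ord_div {x y : L} (hx : x ≠ 0) (hy : y ≠ 0) : ord B (x / y) = ord B x - ord B y := by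
  rw [div_eq_mul_inv, ord_mul hx (inv_ne_zero hy), ord_inv hy]; ring

theorem ord_pow {x : L} (hx : x ≠ 0) (n : ℕ) : ord B (x ^ n) = n * ord B x := by
  induction n with
  | zero => simp [ord_one]
  | succ k ih => rw [pow_succ, ord_mul (pow_ne_zero _ hx) hx, ih]; push_cast; ring

theorem ord_zpow {x : L} (hx : x ≠ 0) (n : ℤ) : ord B (x ^ n) = n * ord B x := by
  obtain ⟨k, rfl | rfl⟩ := n.eq_nat_or_neg
  · rw [zpow_natCast, ord_pow hx]
  · rw [zpow_neg, ord_inv (zpow_ne_zero _ hx), zpow_natCast, ord_pow hx]; ring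

theorem ord_prod {ι : Type*} (s : Finset ι) (f : ι → L) (hf : ∀ i ∈ s, f i ≠ 0) :
    ord B (∏ i ∈ s, f i) = ∑ i ∈ s, ord B (f i) := by
  classical
  induction s using Finset.induction_on with
  | empty => simp [ord_one]
  | insert a s ha ih =>
    rw [Finset.prod_insert ha, Finset.sum_insert ha, ord_mul (hf a (by simp)), ih]
    · exact fun i hi => hf i (by simp [hi])
    · exact Finset.prod_ne_zero_iff.2 fun i hi => hf i (by simp [hi])

theorem powSubmodule_anti {m n : ℤ} (h : m ≤ n) : powSubmodule B L n ≤ powSubmodule B L m := by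
  intro x hx
  by_cases h0 : x = 0
  · simp [h0]
  rw [mem_powSubmodule_iff_ord h0] at hx ⊢
  omega

theorem mul_mem_powSubmodule {m n : ℤ} {x y : L} (hx : x ∈ powSubmodule B L m)
    (hy : y ∈ powSubmodule B L n) : x * y ∈ powSubmodule B L (m + n) := by
  by_cases h0 : x = 0
  · simp [h0]
  by_cases h1 : y = 0
  · simp [h1]
  rw [mem_powSubmodule_iff_ord h0] at hx
  rw [mem_powSubmodule_iff_ord h1] at hy
  rw [mem_powSubmodule_iff_ord (mul_ne_zero h0 h1), ord_mul h0 h1]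
  omega

theorem mul_mem_powSubmodule_iff {m : ℤ} {x y : L} (hx : x ≠ 0) :
    x * y ∈ powSubmodule B L m ↔ y ∈ powSubmodule B L (m - ord B x) := by
  by_cases h1 : y = 0
  · simp [h1]
  rw [mem_powSubmodule_iff_ord (mul_ne_zero hx h1), ord_mul hx h1, mem_powSubmodule_iff_ord h1]
  omega

theorem mem_powSubmodule_zero {x : L} : x ∈ powSubmodule B L 0 ↔ ∃ y : B, algebraMap B L y = x := by
  simp [mem_powSubmodule, eq_comm]

theorem algebraMap_mem_powSubmodule_zero (y : B) : algebraMap B L y ∈ powSubmodule B L 0 :=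
  mem_powSubmodule_zero.2 ⟨y, rfl⟩

theorem algebraMap_mem_powSubmodule {y : B} {n : ℕ} :
    algebraMap B L y ∈ powSubmodule B L n ↔ y ∈ IsLocalRing.maximalIdeal B ^ n := by
  rw [(irreducible_unif B).maximalIdeal_eq, Ideal.span_singleton_pow, Ideal.mem_span_singleton',
    mem_powSubmodule]
  refine exists_congr fun a => ?_
  rw [zpow_natCast, unifL, ← map_pow, ← map_mul, eq_comm, (IsFractionRing.injective B L).eq_iff]

theorem algebraMap_mem_powSubmodule_one {y : B} :
    algebraMap B L y ∈ powSubmodule B L 1 ↔ y ∈ IsLocalRing.maximalIdeal B := by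
  simpa using algebraMap_mem_powSubmodule (L := L) (y := y) (n := 1)

theorem exists_mem_powSubmodule (x : L) : ∃ n : ℤ, x ∈ powSubmodule B L n := by
  by_cases h : x = 0
  · exact ⟨0, by simp [h]⟩
  · exact ⟨ord B x, (mem_powSubmodule_iff_ord h).2 le_rfl⟩

theorem ord_algebraMap_nonneg (y : B) : 0 ≤ ord B (algebraMap B L y) := by
  by_cases h : algebraMap B L y = 0
  · simp [ord, h]
  · exact (mem_powSubmodule_iff_ord h).1 (algebraMap_mem_powSubmodule_zero y)

theorem eq_zero_of_forall_mem {x : L} (h : ∀ n : ℤ, ∃ m ≥ n, x ∈ powSubmodule B L m) : x = 0 := by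
  by_contra h0
  obtain ⟨m, hm, hx⟩ := h (ord B x + 1)
  rw [mem_powSubmodule_iff_ord h0] at hx
  omega

/-- A term of least valuation, if that were below `n`, could not be cancelled by the others, whose
valuations are all strictly larger. -/
theorem forall_mem_powSubmodule_of_sum_mem {ι : Type*} (s : Finset ι) (f : ι → L) (n : ℤ)
    (hinj : ∀ i ∈ s, ∀ j ∈ s, f i ≠ 0 → f j ≠ 0 → ord B (f i) = ord B (f j) → i = j)
    (hsum : ∑ i ∈ s, f i ∈ powSubmodule B L n) : ∀ i ∈ s, f i ∈ powSubmodule B L n := by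
  classical
  by_contra! hcon
  obtain ⟨i₀, hi₀, hf₀⟩ := hcon
  let T := s.filter fun i => f i ≠ 0
  have hne₀ : f i₀ ≠ 0 := fun h => hf₀ (by simp [h])
  obtain ⟨i, hiT, hi⟩ := Finset.exists_min_image T (fun i => ord B (f i))
    ⟨i₀, Finset.mem_filter.2 ⟨hi₀, hne₀⟩⟩
  obtain ⟨his, hine⟩ := Finset.mem_filter.1 hiT
  have hlt : ord B (f i) < n := by
    have h1 := hi i₀ (Finset.mem_filter.2 ⟨hi₀, hne₀⟩)
    rw [mem_powSubmodule_iff_ord hne₀] at hf₀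
    omega
  have hrest : ∑ j ∈ s.erase i, f j ∈ powSubmodule B L (ord B (f i) + 1) := by
    refine Submodule.sum_mem _ fun j hj => ?_
    obtain ⟨hji, hjs⟩ := Finset.mem_erase.1 hj
    by_cases hj0 : f j = 0
    · simp [hj0]
    rw [mem_powSubmodule_iff_ord hj0]
    have h1 := hi j (Finset.mem_filter.2 ⟨hjs, hj0⟩)
    have h2 : ord B (f i) ≠ ord B (f j) := fun h => hji (hinj i his j hjs hine hj0 h).symm
    omega
  have h3 : f i ∈ powSubmodule B L (ord B (f i) + 1) := by
    have : f i = ∑ j ∈ s, f j - ∑ j ∈ s.erase i, f j := by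
      rw [← Finset.add_sum_erase s f his]; ring
    have h4 := Submodule.sub_mem _ (powSubmodule_anti (by omega) hsum) hrest
    rwa [← this] at h4
  rw [mem_powSubmodule_iff_ord hine] at h3
  omega

section Action

variable {G : Type*} [Group G] [MulSemiringAction G B] [MulSemiringAction G L]
  [SMulDistribClass G B L]

/-- A ring automorphism of `B` preserves irreducibility, so it moves the uniformizer only by a unit.
-/
theorem smul_mem_powSubmodule (g : G) {n : ℤ} {x : L} (hx : x ∈ powSubmodule B L n) :
    g • x ∈ powSubmodule B L n := by
  have h1 : Irreducible (g • unif B) :=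
    (MulEquiv.irreducible_iff (MulSemiringAction.toRingEquiv G B g)).2 (irreducible_unif B)
  obtain ⟨u, hu⟩ := IsDiscreteValuationRing.associated_of_irreducible B (irreducible_unif B) h1
  have h2 : g • unifL B L = algebraMap B L u * unifL B L ^ (1 : ℤ) := by
    rw [unifL, ← algebraMap.smul', ← hu, map_mul, mul_comm, zpow_one]
  have h3 : ord B (g • unifL B L) = 1 := by rw [h2, ord_unit_mul_zpow]
  have h0 : g • unifL B L ≠ 0 := by simpa [smul_eq_zero_iff_eq] using unifL_ne_zero B L
  obtain ⟨y, rfl⟩ := mem_powSubmodule.1 hx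
  have h4 : g • (unifL B L ^ n) = (g • unifL B L) ^ n :=
    map_zpow₀ (MulSemiringAction.toRingHom G L g) _ _
  rw [smul_mul', ← algebraMap.smul', h4, ← zero_add n]
  refine mul_mem_powSubmodule (algebraMap_mem_powSubmodule_zero _) ?_
  rw [mem_powSubmodule_iff_ord (zpow_ne_zero _ h0), zero_add, ord_zpow h0, h3]
  omega

theorem smul_mem_powSubmodule_iff (g : G) {n : ℤ} {x : L} :
    g • x ∈ powSubmodule B L n ↔ x ∈ powSubmodule B L n :=
  ⟨fun h => by simpa using smul_mem_powSubmodule g⁻¹ h, smul_mem_powSubmodule g⟩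

theorem ord_smul (g : G) (x : L) : ord B (g • x) = ord B x := by
  by_cases hx : x = 0
  · simp [hx]
  have hgx : g • x ≠ 0 := by simpa [smul_eq_zero_iff_eq] using hx
  rw [ord_eq_iff hgx, smul_mem_powSubmodule_iff, smul_mem_powSubmodule_iff, ← ord_eq_iff hx]

end Action

end Ord

end DVRExtension

/-! ### Ramification index and inertia -/

namespace DVRExtension

section Ramification

open IsLocalRing

theorem maximalIdeal_liesOver (C B : Type*) [CommRing C] [IsLocalRing C] [CommRing B]
    [IsLocalRing B] [Algebra C B] [Algebra.IsIntegral C B] :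
    (maximalIdeal B).LiesOver (maximalIdeal C) :=
  ⟨(eq_maximalIdeal (Ideal.isMaximal_comap_of_isIntegral_of_isMaximal (R := C)
    (maximalIdeal B))).symm⟩

/-- In a Galois extension of discrete valuation rings with perfect residue field, the ramification
index is the order of the inertia group. -/
theorem map_maximalIdeal_eq_pow_card_inertia (C B G : Type*) [CommRing C] [IsDomain C]
    [IsLocalRing C] [IsPrincipalIdealRing C] [PerfectField (ResidueField C)]
    [CommRing B] [IsDomain B] [IsDiscreteValuationRing B] [Algebra C B] [Module.Finite C B]
    [FaithfulSMul C B] [Group G] [Finite G] [MulSemiringAction G B] [IsGaloisGroup G C B] :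
    (maximalIdeal C).map (algebraMap C B) =
      maximalIdeal B ^ Nat.card ((maximalIdeal B).inertia G) := by
  have hint : Algebra.IsIntegral C B := inferInstance
  have hlies := maximalIdeal_liesOver C B
  have hperf : PerfectField (maximalIdeal C).ResidueField :=
    PerfectField.of_ringEquiv (K := ResidueField C)
      (RingEquiv.ofBijective (algebraMap (C ⧸ maximalIdeal C) (maximalIdeal C).ResidueField)
        (Ideal.bijective_algebraMap_quotient_residueField _))
  have hinj := FaithfulSMul.algebraMap_injective C B
  have htf : Module.IsTorsionFree C B := by
    rw [Module.isTorsionFree_iff_faithfulSMul]; infer_instance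
  have hne : (maximalIdeal C).map (algebraMap C B) ≠ ⊥ := by
    intro h
    rw [Ideal.map_eq_bot_iff_of_injective hinj] at h
    have h1 : IsField C := isField_iff_maximalIdeal_eq.2 h
    exact IsDiscreteValuationRing.not_isField B (isField_of_isIntegral_of_isField' h1)
  have h1 := Ideal.card_inertia_eq_ramificationIdxIn (G := G) (maximalIdeal C) (maximalIdeal B)
  rw [Ideal.ramificationIdxIn_eq_ramificationIdx _ (maximalIdeal B) G,
    Ideal.IsDedekindDomain.ramificationIdx_eq_multiplicity _ _ hne] at h1
  obtain ⟨n, hn⟩ := IsDiscreteValuationRing.ideal_eq_span_pow_irreducible hne (irreducible_unif B)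
  rw [← Ideal.span_singleton_pow, ← (irreducible_unif B).maximalIdeal_eq] at hn
  rw [h1, hn, multiplicity_pow_self]
  · exact IsDiscreteValuationRing.not_a_field B
  · exact fun h => (maximalIdeal.isMaximal B).ne_top (Ideal.isUnit_iff.1 h)

theorem ord_eq_of_span_eq_pow {B L : Type*} [CommRing B] [IsDomain B] [IsDiscreteValuationRing B]
    [Field L] [Algebra B L] [IsFractionRing B L] {y : B} {n : ℕ}
    (h : Ideal.span {y} = maximalIdeal B ^ n) : ord B (algebraMap B L y) = n := by
  have hy0 : algebraMap B L y ≠ 0 := by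
    rw [Ne, IsFractionRing.to_map_eq_zero_iff]
    rintro rfl
    rw [Ideal.span_singleton_eq_bot.2 rfl] at h
    exact pow_ne_zero _ (IsDiscreteValuationRing.not_a_field B) h.symm
  apply le_antisymm
  · have h2 : unif B ^ n ∈ maximalIdeal B ^ n :=
      Ideal.pow_mem_pow (by rw [(irreducible_unif B).maximalIdeal_eq]
                            exact Ideal.mem_span_singleton_self _) _
    rw [← h, Ideal.mem_span_singleton'] at h2
    obtain ⟨a, ha⟩ := h2
    have h3 := congrArg (algebraMap B L) ha
    rw [map_mul, map_pow, ← unifL, ← zpow_natCast] at h3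
    have ha0 : algebraMap B L a ≠ 0 := by
      intro h0
      rw [h0, zero_mul] at h3
      exact zpow_ne_zero _ (unifL_ne_zero B L) h3.symm
    have h4 := congrArg (ord B) h3
    have h5 := ord_algebraMap_nonneg (L := L) a
    rw [ord_unifL_zpow, ord_mul ha0 hy0] at h4
    omega
  · rw [← mem_powSubmodule_iff_ord hy0, algebraMap_mem_powSubmodule, ← h]
    exact Ideal.mem_span_singleton_self _

theorem ord_algebraMap_unif (A B L G : Type*) [CommRing A] [IsDomain A]
    [IsDiscreteValuationRing A] [PerfectField (ResidueField A)] [CommRing B] [IsDomain B]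
    [IsDiscreteValuationRing B] [Algebra A B] [Module.Finite A B] [FaithfulSMul A B] [Field L]
    [Algebra B L] [IsFractionRing B L] [Group G] [Finite G] [MulSemiringAction G B]
    [IsGaloisGroup G A B] :
    ord B (algebraMap B L (algebraMap A B (unif A))) =
      Nat.card ((maximalIdeal B).inertia G) := by
  refine ord_eq_of_span_eq_pow ?_
  have h := map_maximalIdeal_eq_pow_card_inertia A B G
  rwa [(irreducible_unif A).maximalIdeal_eq, Ideal.map_span, Set.image_singleton] at h

/-- A quotient in `B` of two fixed elements is fixed, so divisibility descends to the fixed ring.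
Together with noetherianity this makes the fixed ring principal and local. -/
instance fixedPoints_valuationRing (A B : Type*) {G : Type*} [CommRing A] [CommRing B] [IsDomain B]
    [IsDiscreteValuationRing B] [Algebra A B] [Group G] [MulSemiringAction G B]
    [SMulCommClass G A B] (H : Subgroup G) :
    ValuationRing (FixedPoints.subalgebra A B H) := by
  refine { cond' := fun a b => ?_ }
  have key : ∀ (a b : FixedPoints.subalgebra A B H) (c : B), (a : B) * c = b →
      ∃ c : FixedPoints.subalgebra A B H, a * c = b := by
    intro a b c hc
    by_cases ha : a = 0
    · refine ⟨0, Subtype.ext ?_⟩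
      rw [← hc, ha]; simp
    refine ⟨⟨c, fun h => ?_⟩, Subtype.ext hc⟩
    have h1 : h • ((a : B) * c) = (a : B) * c := by rw [hc]; exact b.2 h
    rw [smul_mul', show h • (a : B) = a from a.2 h] at h1
    exact mul_left_cancel₀ (fun h0 => ha (Subtype.ext h0)) h1
  obtain ⟨c, hc | hc⟩ := ValuationRing.cond (a : B) (b : B)
  · obtain ⟨d, hd⟩ := key a b c hc
    exact ⟨d, Or.inl hd⟩
  · obtain ⟨d, hd⟩ := key b a c hc
    exact ⟨d, Or.inr hd⟩

/-- The valuation of an element of `L` fixed by a group `H` of inertia is divisible by `|H|`. -/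
theorem card_dvd_ord (A : Type*) {B L G : Type*} [CommRing A] [IsDomain A]
    [IsDiscreteValuationRing A] [PerfectField (ResidueField A)] [CommRing B] [IsDomain B]
    [IsDiscreteValuationRing B] [Algebra A B] [Module.Finite A B] [FaithfulSMul A B] [Field L]
    [Algebra B L] [IsFractionRing B L] [Group G] [Finite G] [MulSemiringAction G B]
    [IsGaloisGroup G A B] [MulSemiringAction G L] [SMulDistribClass G B L] (H : Subgroup G)
    (hH : H ≤ (maximalIdeal B).inertia G) {x : L}
    (hfix : ∀ σ ∈ H, σ • x = x) : (Nat.card H : ℤ) ∣ ord B x := by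
  let C := FixedPoints.subalgebra A B H
  have hfinC : Module.Finite A C := Module.Finite.of_injective C.val.toLinearMap
    Subtype.val_injective
  have hnoeth : IsNoetherianRing C := IsNoetherianRing.of_finite A C
  have hfin : Module.Finite C B := Module.Finite.of_restrictScalars_finite A C B
  have hpid : IsPrincipalIdealRing C := inferInstance
  have hfA : FaithfulSMul A C := by
    rw [faithfulSMul_iff_algebraMap_injective]
    intro a b hab
    exact FaithfulSMul.algebraMap_injective A B (congrArg Subtype.val hab)
  have hf : FaithfulSMul C B := by
    rw [faithfulSMul_iff_algebraMap_injective]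
    exact Subtype.val_injective
  have hl := maximalIdeal_liesOver A C
  have hlh : IsLocalHom (algebraMap A C) := by
    refine ((local_hom_TFAE (algebraMap A C)).out 0 4).2 ?_
    exact hl.over.symm
  have hperf : PerfectField (ResidueField C) := by
    have : Algebra.IsIntegral (ResidueField A) (ResidueField C) := inferInstance
    have : Algebra.IsAlgebraic (ResidueField A) (ResidueField C) := inferInstance
    exact Algebra.IsAlgebraic.perfectField (ResidueField A)
  -- All of `H` is inertia for `B` over the fixed ring `C`, so a uniformizer of `C` has valuation
  -- `|H|` in `B`.
  have hmap := map_maximalIdeal_eq_pow_card_inertia C B H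
  have hcard : Nat.card ((maximalIdeal B).inertia H) = Nat.card H := by
    have : (maximalIdeal B).inertia H = ⊤ := by
      rw [eq_top_iff]
      intro σ _
      exact hH σ.2
    rw [this, Subgroup.card_top]
  rw [hcard] at hmap
  have hB : ∀ c : C, (Nat.card H : ℤ) ∣ ord B (algebraMap B L (c : B)) := by
    intro c
    by_cases hc : c = 0
    · simp [hc, ord]
    have hdvr : IsDiscreteValuationRing C :=
      { not_a_field' := by
          intro h
          rw [h, Ideal.map_bot] at hmap
          exact pow_ne_zero _ (IsDiscreteValuationRing.not_a_field B) hmap.symm }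
    obtain ⟨k, u, hu⟩ := IsDiscreteValuationRing.eq_unit_mul_pow_irreducible hc (irreducible_unif C)
    have hinj : Function.Injective (algebraMap B L) := IsFractionRing.injective B L
    have hγ0 : algebraMap B L (unif C : C) ≠ 0 := by
      rw [Ne, IsFractionRing.to_map_eq_zero_iff, ZeroMemClass.coe_eq_zero]
      exact (irreducible_unif C).ne_zero
    have hu0 : algebraMap B L ((u : C) : B) ≠ 0 := by
      rw [Ne, IsFractionRing.to_map_eq_zero_iff, ZeroMemClass.coe_eq_zero]
      exact u.ne_zero
    rw [(irreducible_unif C).maximalIdeal_eq, Ideal.map_span, Set.image_singleton] at hmap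
    have h1 : ord B (algebraMap B L (unif C : C)) = Nat.card H := ord_eq_of_span_eq_pow hmap
    have h2 : ord B (algebraMap B L ((u : C) : B)) = 0 := by
      have h3 : IsUnit (algebraMap C B (u : C)) := u.isUnit.map _
      obtain ⟨w, hw⟩ := h3
      have := ord_unit_mul_zpow (L := L) w 0
      rwa [hw, zpow_zero, mul_one] at this
    rw [hu, Subalgebra.coe_mul, Subalgebra.coe_pow, map_mul, map_pow,
      ord_mul hu0 (pow_ne_zero _ hγ0), ord_pow hγ0, h1, h2]
    exact ⟨k, by ring⟩
  by_cases hx : x = 0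
  · simp [ord, hx]
  obtain ⟨b, s, hs, rfl⟩ := IsFractionRing.div_surjective B x
  have halg : Algebra.IsAlgebraic A B := inferInstance
  -- Take the denominator in `A`: it is then fixed by `H`, and hence so is the numerator.
  obtain ⟨c, d, hd, h⟩ := (halg.isAlgebraic s).exists_smul_eq_mul b hs
  have hinj : Function.Injective (algebraMap B L) := IsFractionRing.injective B L
  have hs0 : algebraMap B L s ≠ 0 := IsFractionRing.to_map_ne_zero_of_mem_nonZeroDivisors hs
  have hd0 : algebraMap B L (algebraMap A B d) ≠ 0 := by
    rw [Ne, IsFractionRing.to_map_eq_zero_iff, FaithfulSMul.algebraMap_eq_zero_iff]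
    exact hd
  have heq : algebraMap B L b / algebraMap B L s =
      algebraMap B L c / algebraMap B L (algebraMap A B d) := by
    rw [div_eq_div_iff hs0 hd0, ← map_mul, ← map_mul]
    congr 1
    rw [Algebra.smul_def] at h
    linear_combination h
  rw [heq] at hx hfix ⊢
  have hc0 : algebraMap B L c ≠ 0 := fun h0 => hx (by rw [h0, zero_div])
  rw [ord_div hc0 hd0]
  refine dvd_sub ?_ ?_
  · refine hB ⟨c, fun σ => hinj ?_⟩
    have h1 := hfix σ σ.2
    rw [smul_div₀', ← algebraMap.smul', ← algebraMap.smul', smul_algebraMap,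
      div_left_inj' hd0] at h1
    exact h1
  · exact hB (algebraMap A C d)

end Ramification
end DVRExtension

/-! ### Expansions in a uniformizer and Euler's trace formula -/

namespace DVRExtension

section TotallyRamified

variable {B L H : Type*} [CommRing B] [IsDomain B] [IsDiscreteValuationRing B] [Field L]
  [Algebra B L] [IsFractionRing B L] [Group H] [Fintype H] [MulSemiringAction H B]
  [MulSemiringAction H L] [SMulDistribClass H B L]

variable (B L H) in
/-- The values of the valuation of `L` on the elements fixed by `H` are divisible by `|H|`. -/
def IsTotallyRamified : Prop :=
  ∀ x : L, (∀ σ : H, σ • x = x) → (Fintype.card H : ℤ) ∣ ord B x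

/-- The sum of the conjugates of `x` under the finite group `H`. -/
def trace (H : Type*) {L : Type*} [Group H] [Fintype H] [Field L] [MulSemiringAction H L]
    (x : L) : L := ∑ σ : H, σ • x

theorem smul_unifL_ne_zero (σ : H) : σ • unifL B L ≠ 0 := by
  simpa [smul_eq_zero_iff_eq] using unifL_ne_zero B L

theorem trace_smul (τ : H) (x : L) : trace H (τ • x) = trace H x := by
  simp only [trace, smul_smul]
  exact Fintype.sum_bijective (· * τ) (Group.mulRight_bijective τ) _ _ fun _ => rfl

theorem trace_sum {ι : Type*} (s : Finset ι) (f : ι → L) :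
    trace H (∑ i ∈ s, f i) = ∑ i ∈ s, trace H (f i) := by
  simp only [trace, Finset.smul_sum]
  exact Finset.sum_comm

theorem trace_mul_of_fixed {c : L} (hc : ∀ σ : H, σ • c = c) (x : L) :
    trace H (c * x) = c * trace H x := by
  simp [trace, smul_mul', hc, Finset.mul_sum]

namespace IsTotallyRamified

variable (ht : IsTotallyRamified B L H)
include ht

/-- The valuation of a nonzero `c i * Π ^ i` is congruent to `i` modulo `|H|`, so distinct terms
have distinct valuations and cannot cancel. -/
theorem forall_mul_pow_mem {c : ℕ → L} (hc : ∀ i, ∀ σ : H, σ • c i = c i) {n : ℤ}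
    (h : ∑ i ∈ Finset.range (Fintype.card H), c i * unifL B L ^ i ∈ powSubmodule B L n) :
    ∀ i < Fintype.card H, c i * unifL B L ^ i ∈ powSubmodule B L n := by
  have hp := unifL_ne_zero B L
  intro i hi
  refine forall_mem_powSubmodule_of_sum_mem _ _ n ?_ h i (Finset.mem_range.2 hi)
  intro i hi j hj hi0 hj0 hij
  rw [Finset.mem_range] at hi hj
  have hci : c i ≠ 0 := left_ne_zero_of_mul hi0
  have hcj : c j ≠ 0 := left_ne_zero_of_mul hj0
  rw [ord_mul hci (pow_ne_zero _ hp), ord_mul hcj (pow_ne_zero _ hp), ord_pow hp, ord_pow hp,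
    ord_unifL] at hij
  have h1 := dvd_sub (ht _ (hc j)) (ht _ (hc i))
  have h2 : ord B (c j) - ord B (c i) = (i : ℤ) - j := by linarith
  rw [h2] at h1
  have h3 := Int.eq_zero_of_abs_lt_dvd h1 (by rw [abs_lt]; omega)
  omega

/-- The powers of `Π` are independent over the fixed field by `forall_mul_pow_mem`, and there are
`|H|` of them, which is the degree of `L` over that field by Artin's theorem. -/
theorem exists_expansion [FaithfulSMul H L] (x : L) : ∃ c : ℕ → L,
    (∀ i, ∀ σ : H, σ • c i = c i) ∧
      x = ∑ i ∈ Finset.range (Fintype.card H), c i * unifL B L ^ i := by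
  have hp := unifL_ne_zero B L
  let F := FixedPoints.subfield H L
  let b : Fin (Fintype.card H) → L := fun i => unifL B L ^ (i : ℕ)
  have hli : LinearIndependent F b := by
    rw [Fintype.linearIndependent_iff]
    intro g hg i
    let c : ℕ → L := fun j => if hj : j < Fintype.card H then (g ⟨j, hj⟩ : L) else 0
    have hc : ∀ j, ∀ σ : H, σ • c j = c j := by
      intro j σ
      simp only [c]
      split_ifs with hj
      · exact (g ⟨j, hj⟩).2 σ
      · simp
    have hsum : ∑ j ∈ Finset.range (Fintype.card H), c j * unifL B L ^ j = 0 := by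
      rw [← hg, Finset.sum_range]
      refine Finset.sum_congr rfl fun j _ => ?_
      simp [c, b, Subfield.smul_def]
    have h0 : c i * unifL B L ^ (i : ℕ) = 0 := eq_zero_of_forall_mem (B := B) fun n =>
      ⟨n, le_rfl, ht.forall_mul_pow_mem hc (by rw [hsum]; exact zero_mem _) i i.2⟩
    have h1 : c i = 0 := (mul_eq_zero.1 h0).resolve_right (pow_ne_zero _ hp)
    simp only [c, i.2, dif_pos] at h1
    exact Subtype.ext h1
  have hcard : Fintype.card (Fin (Fintype.card H)) = Module.finrank F L := by
    rw [Fintype.card_fin]; exact (FixedPoints.finrank_eq_card H L).symm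
  have hspan := hli.span_eq_top_of_card_eq_finrank' hcard
  have hx : x ∈ Submodule.span F (Set.range b) := hspan ▸ Submodule.mem_top
  obtain ⟨g, hg⟩ := (Submodule.mem_span_range_iff_exists_fun F).1 hx
  refine ⟨fun j => if hj : j < Fintype.card H then (g ⟨j, hj⟩ : L) else 0, fun j σ => ?_, ?_⟩
  · dsimp only
    split_ifs with hj
    · exact (g ⟨j, hj⟩).2 σ
    · simp
  · rw [← hg, Finset.sum_range]
    refine Finset.sum_congr rfl fun j _ => ?_
    simp [b, Subfield.smul_def]

theorem smul_unifL_injective [FaithfulSMul H L] :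
    Function.Injective fun σ : H => σ • unifL B L := by
  intro σ τ hst
  refine FaithfulSMul.eq_of_smul_eq_smul (α := L) fun x => ?_
  obtain ⟨c, hc, hx⟩ := ht.exists_expansion x
  rw [hx]
  simp only [Finset.smul_sum, smul_mul', hc, smul_pow']
  simp only at hst
  rw [hst]

/-- For `σ` in a totally ramified group, congruences for `σ` may be checked on a uniformizer. -/
theorem forall_smul_sub_mem_iff [FaithfulSMul H L] (σ : H) (s : ℕ) :
    (∀ x : B, σ • x - x ∈ IsLocalRing.maximalIdeal B ^ s) ↔
      σ • unifL B L - unifL B L ∈ powSubmodule B L s := by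
  constructor
  · intro h
    have := h (unif B)
    rwa [← algebraMap_mem_powSubmodule (L := L), map_sub, algebraMap.smul'] at this
  · intro h x
    rw [← algebraMap_mem_powSubmodule (L := L), map_sub, algebraMap.smul']
    obtain ⟨c, hc, hx⟩ := ht.exists_expansion (algebraMap B L x)
    have hmem := ht.forall_mul_pow_mem hc (n := 0) (hx ▸ algebraMap_mem_powSubmodule_zero x)
    rw [hx]
    simp only [Finset.smul_sum, smul_mul', hc, smul_pow', ← Finset.sum_sub_distrib, ← mul_sub]
    refine Submodule.sum_mem _ fun i hi => ?_
    by_cases hci : c i = 0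
    · simp [hci]
    have hp := unifL_ne_zero B L
    have h1 := hmem i (Finset.mem_range.1 hi)
    rw [mem_powSubmodule_iff_ord (mul_ne_zero hci (pow_ne_zero _ hp)),
      ord_mul hci (pow_ne_zero _ hp), ord_pow hp, ord_unifL] at h1
    -- The valuation of `c i` is at least `-i > -|H|` and is a multiple of `|H|`.
    have h2 : 0 ≤ ord B (c i) := by
      obtain ⟨k, hk⟩ := ht _ (hc i)
      rw [Finset.mem_range] at hi
      by_contra hneg
      have h3 : k ≤ -1 := by
        by_contra h4
        have : 0 ≤ (Fintype.card H : ℤ) * k := mul_nonneg (by positivity) (by omega)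
        omega
      have : (Fintype.card H : ℤ) * k ≤ (Fintype.card H : ℤ) * (-1) :=
        mul_le_mul_of_nonneg_left h3 (by positivity)
      omega
    rw [← zero_add (s : ℤ)]
    refine mul_mem_powSubmodule ((mem_powSubmodule_iff_ord hci).2 h2) ?_
    obtain ⟨y, hy⟩ : ∃ y : B, algebraMap B L y * (σ • unifL B L - unifL B L) =
        (σ • unifL B L) ^ i - unifL B L ^ i := by
      obtain ⟨y, hy⟩ := sub_dvd_pow_sub_pow (σ • unif B) (unif B) i
      refine ⟨y, ?_⟩
      rw [unifL, ← algebraMap.smul', ← map_sub, ← map_mul, mul_comm, ← hy]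
      simp
    rw [← hy, ← zero_add (s : ℤ)]
    exact mul_mem_powSubmodule (algebraMap_mem_powSubmodule_zero y) h

end IsTotallyRamified

open scoped Classical in
variable (B L H) in
/-- The product of the differences `Π - σ Π` for `σ ≠ 1`, a generator of the different. -/
noncomputable def differentElement : L :=
  ∏ σ ∈ Finset.univ.erase (1 : H), (unifL B L - σ • unifL B L)

namespace IsTotallyRamified

variable (ht : IsTotallyRamified B L H)
include ht

theorem differentElement_ne_zero [FaithfulSMul H L] : differentElement B L H ≠ 0 := by
  classical
  refine Finset.prod_ne_zero_iff.2 fun σ hσ h => (Finset.mem_erase.1 hσ).1 ?_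
  refine ht.smul_unifL_injective ?_
  simp only [one_smul]
  exact (sub_eq_zero.1 h).symm

/-- Euler's formula for the trace. -/
theorem trace_div_differentElement [FaithfulSMul H L] {c : ℕ → L}
    (hc : ∀ i, ∀ σ : H, σ • c i = c i) :
    trace H ((∑ i ∈ Finset.range (Fintype.card H), c i * unifL B L ^ i) /
      differentElement B L H) = c (Fintype.card H - 1) := by
  classical
  open Polynomial in
  let P : L[X] := ∑ i ∈ Finset.range (Fintype.card H), C (c i) * X ^ i
  have hdeg : P.degree < (Finset.univ : Finset H).card := by
    rw [Polynomial.degree_lt_iff_coeff_zero]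
    intro m hm
    simp only [P, Polynomial.finsetSum_coeff, Polynomial.coeff_C_mul, Polynomial.coeff_X_pow]
    refine Finset.sum_eq_zero fun i hi => ?_
    rw [Finset.mem_range] at hi
    rw [Finset.card_univ] at hm
    rw [if_neg (by omega), mul_zero]
  -- Interpolating `P` at the conjugates of `Π` gives its top coefficient as the sum of `P(σΠ) / ∏
  -- (σΠ - τΠ)` over `τ ≠ σ`. Each summand is the `σ`-conjugate of `P(Π) / δ`.
  have h1 := Lagrange.coeff_eq_sum (s := Finset.univ) (v := fun σ : H => σ • unifL B L)
    (ht.smul_unifL_injective.injOn) hdeg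
  have h2 : P.coeff ((Finset.univ : Finset H).card - 1) = c (Fintype.card H - 1) := by
    simp only [P, Polynomial.finsetSum_coeff, Polynomial.coeff_C_mul, Polynomial.coeff_X_pow,
      Finset.card_univ, mul_ite, mul_one, mul_zero]
    rw [Finset.sum_ite_eq, if_pos]
    have : 0 < Fintype.card H := Fintype.card_pos
    rw [Finset.mem_range]; omega
  rw [← h2, h1, trace]
  refine Finset.sum_congr rfl fun σ _ => ?_
  rw [smul_div₀']
  congr 1
  · simp only [P, Polynomial.eval_finsetSum, Polynomial.eval_mul, Polynomial.eval_C,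
      Polynomial.eval_pow, Polynomial.eval_X, Finset.smul_sum, smul_mul', hc, smul_pow']
  · rw [differentElement, Finset.smul_prod']
    refine Finset.prod_bij (fun τ _ => σ * τ) ?_ ?_ ?_ ?_
    · intro τ hτ
      simpa using (Finset.mem_erase.1 hτ).1
    · intro a _ b _ h
      exact mul_left_cancel h
    · intro τ hτ
      refine ⟨σ⁻¹ * τ, ?_, by simp⟩
      have := (Finset.mem_erase.1 hτ).1
      simp only [Finset.mem_erase, Finset.mem_univ, and_true, ne_eq, inv_mul_eq_one]
      exact fun h => this h.symm
    · intro τ _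
      rw [smul_sub, smul_smul]

/-- By Euler's formula the element is the top term in the expansion of `y δ`, and each term of an
expansion is at least as divisible as the sum. -/
theorem trace_mul_pow_mem [FaithfulSMul H L] {n : ℤ} {y : L} (hy : y ∈ powSubmodule B L n) :
    trace H y * unifL B L ^ (Fintype.card H - 1) ∈
      powSubmodule B L (n + ord B (differentElement B L H)) := by
  have hδ := ht.differentElement_ne_zero
  obtain ⟨c, hc, hx⟩ := ht.exists_expansion (y * differentElement B L H)
  have h1 := ht.trace_div_differentElement hc
  rw [← hx, mul_div_cancel_right₀ _ hδ] at h1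
  rw [h1]
  have hpos : 0 < Fintype.card H := Fintype.card_pos
  refine ht.forall_mul_pow_mem hc ?_ _ (by omega)
  rw [← hx]
  exact mul_mem_powSubmodule hy ((mem_powSubmodule_iff_ord hδ).2 le_rfl)

/-- Euler's formula for an expansion with only a top term. It produces elements for which the bound
in `trace_mul_pow_mem` is attained. -/
theorem trace_mul_pow_div [FaithfulSMul H L] {c : L} (hc : ∀ σ : H, σ • c = c) :
    trace H (c * unifL B L ^ (Fintype.card H - 1) / differentElement B L H) = c := by
  have hpos : 0 < Fintype.card H := Fintype.card_pos
  have h := ht.trace_div_differentElement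
    (c := fun i => if i = Fintype.card H - 1 then c else 0) (by
      intro i σ
      split_ifs
      · exact hc σ
      · simp)
  simp only [ite_mul, zero_mul, if_true] at h
  rwa [Finset.sum_ite_eq', if_pos (Finset.mem_range.2 (by omega))] at h

end IsTotallyRamified

variable (B L H) in
/-- The product of the conjugates of the uniformizer. -/
noncomputable def normUnif : L := ∏ σ : H, σ • unifL B L

theorem smul_normUnif (τ : H) : τ • normUnif B L H = normUnif B L H := by
  simp only [normUnif, Finset.smul_prod', smul_smul]
  exact Fintype.prod_bijective (τ * ·) (Group.mulLeft_bijective τ) _ _ fun _ => rfl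

theorem normUnif_ne_zero : normUnif B L H ≠ 0 :=
  Finset.prod_ne_zero_iff.2 fun σ _ => smul_unifL_ne_zero σ

theorem smul_normUnif_zpow (τ : H) (n : ℤ) : τ • normUnif B L H ^ n = normUnif B L H ^ n := by
  have h : τ • normUnif B L H ^ n = (τ • normUnif B L H) ^ n :=
    map_zpow₀ (MulSemiringAction.toRingHom H L τ) _ _
  rw [h, smul_normUnif]

theorem ord_normUnif : ord B (normUnif B L H) = Fintype.card H := by
  rw [normUnif, ord_prod _ _ fun σ _ => smul_unifL_ne_zero σ]
  simp [ord_smul, ord_unifL]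

theorem ord_normUnif_zpow (n : ℤ) : ord B (normUnif B L H ^ n) = Fintype.card H * n := by
  rw [ord_zpow normUnif_ne_zero, ord_normUnif, mul_comm]

end TotallyRamified
end DVRExtension

/-! ### Fixed points of p-groups, and consequences of surjectivity of the trace -/

namespace DVRExtension

/-- The orbit of `x` generates a finite group of exponent `p`, whose order is divisible by `p`. The
number of fixed points is then divisible by `p` too, so `0` is not the only one. -/
theorem exists_fixed_ne_zero_of_isPGroup {p : ℕ} [Fact p.Prime] {H S : Type*} [Group H] [Finite H]
    (hH : IsPGroup p H) [AddCommGroup S] (ρ : H →* AddMonoid.End S) (hS : ∀ x : S, p • x = 0)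
    (T : AddSubgroup S) (hT : ∀ g, ∀ x ∈ T, ρ g x ∈ T) {x : S} (hx : x ∈ T) (hx0 : x ≠ 0) :
    ∃ y ∈ T, y ≠ 0 ∧ ∀ g, ρ g y = y := by
  have hp : p.Prime := Fact.out
  let O : Set S := Set.range fun g => ρ g x
  let T' := AddSubgroup.closure O
  have hT' : ∀ g, ∀ y ∈ T', ρ g y ∈ T' := by
    intro g y hy
    induction hy using AddSubgroup.closure_induction with
    | mem y hy =>
      obtain ⟨g', rfl⟩ := hy
      refine AddSubgroup.subset_closure ⟨g * g', ?_⟩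
      simp [map_mul]
    | zero => simp [T'.zero_mem]
    | add a b _ _ ha hb => rw [map_add]; exact T'.add_mem ha hb
    | neg a _ ha => rw [map_neg]; exact T'.neg_mem ha
  have hfg : AddMonoid.FG T' := by
    rw [← AddGroup.fg_iff_addMonoid_fg]
    exact (AddGroup.fg_iff_addSubgroup_fg T').2
      ((AddSubgroup.fg_iff T').2 ⟨O, rfl, Set.finite_range _⟩)
  have hfin : Finite T' := by
    refine AddCommGroup.finite_of_fg_isAddTorsion T' fun y => ?_
    refine isOfFinAddOrder_iff_nsmul_eq_zero.2 ⟨p, hp.pos, Subtype.ext ?_⟩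
    simpa using hS y
  let act : MulAction H T' :=
    { smul := fun g y => ⟨ρ g y, hT' g y y.2⟩
      one_smul := fun y => Subtype.ext (by change ρ 1 (y : S) = y; rw [map_one]; rfl)
      mul_smul := fun g g' y => Subtype.ext (by
        change ρ (g * g') (y : S) = ρ g (ρ g' y); rw [map_mul]; rfl) }
  have hxT' : x ∈ T' := AddSubgroup.subset_closure ⟨1, by simp⟩
  have hdvd : p ∣ Nat.card T' := by
    have h1 : addOrderOf (⟨x, hxT'⟩ : T') = p := addOrderOf_eq_prime
      (Subtype.ext (by simpa using hS x)) (fun h => hx0 (congrArg Subtype.val h))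
    rw [← h1]
    exact addOrderOf_dvd_natCard _
  obtain ⟨y, hy, hy0⟩ := hH.exists_fixed_point_of_prime_dvd_card_of_fixed_point T' hdvd
    (a := 0) (fun g => Subtype.ext (map_zero (ρ g)))
  refine ⟨y, ?_, fun h => hy0 (Subtype.ext h.symm), fun g => congrArg Subtype.val (hy g)⟩
  refine (AddSubgroup.closure_le T).2 ?_ y.2
  rintro _ ⟨g, rfl⟩
  exact hT g x hx

section TotallyRamified

variable {B L H : Type*} [CommRing B] [IsDomain B] [IsDiscreteValuationRing B] [Field L]
  [Algebra B L] [IsFractionRing B L] [Group H] [Fintype H] [MulSemiringAction H B]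
  [MulSemiringAction H L] [SMulDistribClass H B L]

namespace IsTotallyRamified

variable (ht : IsTotallyRamified B L H)
include ht

theorem mem_of_mem_add_one {x : L} (hx : ∀ σ : H, σ • x = x) {i n : ℤ}
    (hmem : x ∈ powSubmodule B L i) (hi : (Fintype.card H : ℤ) * n < i) :
    x ∈ powSubmodule B L (Fintype.card H * (n + 1)) := by
  by_cases h0 : x = 0
  · simp [h0]
  rw [mem_powSubmodule_iff_ord h0] at hmem ⊢
  obtain ⟨k, hk⟩ := ht x hx
  have hpos : (0 : ℤ) < Fintype.card H := by exact_mod_cast Fintype.card_pos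
  rw [hk] at hmem ⊢
  have : n < k := lt_of_mul_lt_mul_left (lt_of_lt_of_le hi hmem) hpos.le
  exact mul_le_mul_of_nonneg_left this hpos.le

theorem ord_differentElement [FaithfulSMul H L] {d : ℤ}
    (hd : ∀ σ : H, σ ≠ 1 → ord B (unifL B L - σ • unifL B L) = d) :
    ord B (differentElement B L H) = (Fintype.card H - 1) * d := by
  classical
  have hpos : 0 < Fintype.card H := Fintype.card_pos
  rw [differentElement, ord_prod, Finset.sum_congr rfl fun σ hσ => hd σ (Finset.mem_erase.1 hσ).1,
    Finset.sum_const, Finset.card_erase_of_mem (Finset.mem_univ _), Finset.card_univ, nsmul_eq_mul,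
    Nat.cast_sub hpos, Nat.cast_one]
  intro σ hσ h
  refine (Finset.mem_erase.1 hσ).1 (ht.smul_unifL_injective ?_)
  simpa using (sub_eq_zero.1 h).symm

/-- Let `h = |H|` and `b - 1 = h q + r` with `0 ≤ r < h`. A fixed element of valuation `h q + h ≥ b`
is a trace from `𝔪 ^ b`, so `trace_mul_pow_mem` gives `(h q + h) + (h - 1) ≥ b + v(δ) ≥ b + 2 (h -
1)`, that is `r ≤ 0`. Equality must then hold throughout. -/
theorem ord_sub_eq_two_and_modEq_of_trace_surjective [FaithfulSMul H L] {b : ℤ}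
    (hd : ∀ σ : H, σ ≠ 1 → 2 ≤ ord B (unifL B L - σ • unifL B L))
    (htr : ∀ x ∈ powSubmodule B L b, (∀ σ : H, σ • x = x) →
      ∃ y ∈ powSubmodule B L b, trace H y = x) :
    (∀ σ : H, σ ≠ 1 → ord B (unifL B L - σ • unifL B L) = 2) ∧
      b ≡ 1 [ZMOD Fintype.card H] := by
  classical
  have hp := unifL_ne_zero B L
  set h : ℤ := ((Fintype.card H : ℕ) : ℤ) with hh
  have hpos : 0 < Fintype.card H := Fintype.card_pos
  have hpos' : 0 < h := by rw [hh]; exact_mod_cast hpos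
  have hne : ∀ σ ∈ Finset.univ.erase (1 : H), unifL B L - σ • unifL B L ≠ 0 := by
    intro σ hσ h
    refine (Finset.mem_erase.1 hσ).1 (ht.smul_unifL_injective ?_)
    simpa using (sub_eq_zero.1 h).symm
  let q := (b - 1) / h
  have hq : h * q + (b - 1) % h = b - 1 := Int.mul_ediv_add_emod _ _
  have hr0 : 0 ≤ (b - 1) % h := Int.emod_nonneg _ hpos'.ne'
  have hr1 : (b - 1) % h < h := Int.emod_lt_of_pos _ hpos'
  have hc0 : normUnif B L H ^ (q + 1) ≠ 0 := zpow_ne_zero _ normUnif_ne_zero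
  have hord : ord B (normUnif B L H ^ (q + 1)) = h * q + h := by
    rw [ord_normUnif_zpow]; ring
  obtain ⟨y, hy, hyt⟩ := htr (normUnif B L H ^ (q + 1))
    ((mem_powSubmodule_iff_ord hc0).2 (by omega)) (fun σ => smul_normUnif_zpow σ _)
  have h1 := ht.trace_mul_pow_mem hy
  rw [hyt, mem_powSubmodule_iff_ord (mul_ne_zero hc0 (pow_ne_zero _ hp)),
    ord_mul hc0 (pow_ne_zero _ hp), ord_pow hp, ord_unifL, hord, Nat.cast_sub hpos, ← hh] at h1
  rw [differentElement, ord_prod _ _ hne] at h1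
  have hcard : ∑ σ ∈ Finset.univ.erase (1 : H), (2 : ℤ) = 2 * (h - 1) := by
    rw [Finset.sum_const, Finset.card_erase_of_mem (Finset.mem_univ _), Finset.card_univ,
      nsmul_eq_mul, Nat.cast_sub hpos]
    push_cast; ring
  have hge : ∀ σ ∈ Finset.univ.erase (1 : H), 2 ≤ ord B (unifL B L - σ • unifL B L) :=
    fun σ hσ => hd σ (Finset.mem_erase.1 hσ).1
  have hsum := Finset.sum_le_sum hge
  rw [hcard] at hsum
  push_cast at h1
  have heq : ∑ σ ∈ Finset.univ.erase (1 : H), (2 : ℤ) =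
      ∑ σ ∈ Finset.univ.erase (1 : H), ord B (unifL B L - σ • unifL B L) := by
    rw [hcard]; linarith
  refine ⟨fun σ hσ => ?_, ?_⟩
  · exact ((Finset.sum_eq_sum_iff_of_le hge).1 heq σ
      (Finset.mem_erase.2 ⟨hσ, Finset.mem_univ _⟩)).symm
  · have hr : (b - 1) % h = 0 := by linarith
    exact ((Int.modEq_iff_dvd).2 (Int.dvd_of_emod_eq_zero hr)).symm

/-- With `d = σΠ - Π`, one has `σ ^ j Π ≡ Π + j d` modulo `𝔪 ^ 3`. For `j = p` the term `p d` also
lies in `𝔪 ^ 3`, which is impossible unless `σ ^ p = 1`. -/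
theorem isPGroup_of_ord_sub_eq_two [FaithfulSMul H L] {p : ℕ}
    (hp : (p : B) ∈ IsLocalRing.maximalIdeal B)
    (hd : ∀ σ : H, σ ≠ 1 → ord B (unifL B L - σ • unifL B L) = 2) : IsPGroup p H := by
  intro σ
  refine ⟨1, ?_⟩
  rw [pow_one]
  by_cases hσ1 : σ = 1
  · simp [hσ1]
  set d := σ • unifL B L - unifL B L with hd'
  have hd2 : ∀ τ : H, τ • unifL B L - unifL B L ∈ powSubmodule B L (2 : ℕ) := by
    intro τ
    by_cases hτ : τ = 1
    · simp [hτ]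
    rw [← neg_sub]
    refine Submodule.neg_mem _ ?_
    obtain ⟨n, hn⟩ := exists_mem_powSubmodule (B := B) (unifL B L - τ • unifL B L)
    by_cases h0 : unifL B L - τ • unifL B L = 0
    · simp [h0]
    rw [mem_powSubmodule_iff_ord h0, hd τ hτ]; rfl
  have hσB := (ht.forall_smul_sub_mem_iff σ 2).2 (hd2 σ)
  have hsd : σ • d - d ∈ powSubmodule B L 3 := by
    obtain ⟨y, hy⟩ := mem_powSubmodule.1 (hd2 σ)
    rw [← hd'] at hy
    have h1 : σ • algebraMap B L y - algebraMap B L y ∈ powSubmodule B L 2 := by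
      rw [← algebraMap.smul', ← map_sub]
      exact algebraMap_mem_powSubmodule.2 (hσB y)
    have hu : unifL B L ∈ powSubmodule B L 1 := by
      rw [mem_powSubmodule_iff_ord (unifL_ne_zero B L), ord_unifL]
    -- Apply `σ` to `d = y Π ^ 2`: the change in `y` contributes to `𝔪 ^ 4`, the change in `Π ^ 2`
    -- to `𝔪 ^ 3`.
    have h2 : σ • d - d = (σ • algebraMap B L y - algebraMap B L y) *
        (σ • unifL B L * σ • unifL B L) +
        algebraMap B L y * (d * (σ • unifL B L + unifL B L)) := by
      rw [hy, zpow_natCast, smul_mul', smul_pow']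
      have : algebraMap B L y * unifL B L ^ 2 = σ • unifL B L - unifL B L := by
        rw [← zpow_natCast, ← hy]
      linear_combination (algebraMap B L y) * (σ • unifL B L + unifL B L) * (-1) * this
    rw [h2]
    have hsu := smul_mem_powSubmodule σ hu
    refine Submodule.add_mem _ ?_ ?_
    · exact powSubmodule_anti (by norm_num) (mul_mem_powSubmodule h1 (mul_mem_powSubmodule hsu hsu))
    · have := mul_mem_powSubmodule (algebraMap_mem_powSubmodule_zero (L := L) y)
        (mul_mem_powSubmodule (hd2 σ) (Submodule.add_mem _ hsu hu))
      exact powSubmodule_anti (by norm_num) this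
  have key : ∀ j : ℕ, σ ^ j • unifL B L - unifL B L - j * d ∈ powSubmodule B L 3 := by
    intro j
    induction j with
    | zero => simp
    | succ j ih =>
      have h1 := smul_mem_powSubmodule σ ih
      have h2 : σ ^ (j + 1) • unifL B L - unifL B L - ((j + 1 : ℕ) : L) * d =
          σ • (σ ^ j • unifL B L - unifL B L - j * d) + (j : L) * (σ • d - d) := by
        have h3 : σ • (j : L) = j := map_natCast (MulSemiringAction.toRingHom H L σ) j
        rw [smul_sub, smul_sub, smul_mul', h3, smul_smul, ← pow_succ', hd']
        push_cast; ring
      rw [h2]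
      refine Submodule.add_mem _ h1 ?_
      have h4 := (powSubmodule B L 3).smul_mem (j : B) hsd
      rwa [Algebra.smul_def, map_natCast] at h4
  have hpd : (p : L) * d ∈ powSubmodule B L 3 := by
    have h1 : algebraMap B L (p : B) ∈ powSubmodule B L 1 := algebraMap_mem_powSubmodule_one.2 hp
    rw [map_natCast] at h1
    exact powSubmodule_anti (by norm_num) (mul_mem_powSubmodule h1 (hd2 σ))
  have h3 := Submodule.add_mem _ (key p) hpd
  rw [sub_add_cancel] at h3
  by_contra hne
  have h4 := hd _ hne
  rw [← Submodule.neg_mem_iff, neg_sub] at h3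
  have h0 : unifL B L - σ ^ p • unifL B L ≠ 0 := by
    intro h0
    rw [h0] at h4
    simp [ord] at h4
  rw [mem_powSubmodule_iff_ord h0, h4] at h3
  omega

end IsTotallyRamified

end TotallyRamified
end DVRExtension

/-! ### Normal integral bases over the fixed ring in the weakly ramified case -/

namespace DVRExtension

section TotallyRamified

variable {B L H : Type*} [CommRing B] [IsDomain B] [IsDiscreteValuationRing B] [Field L]
  [Algebra B L] [IsFractionRing B L] [Group H] [Fintype H] [MulSemiringAction H B]
  [MulSemiringAction H L] [SMulDistribClass H B L]

/-- Left translation of functions on a group. -/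
def leftTranslation (H M : Type*) [Group H] [AddCommGroup M] : H →* AddMonoid.End (H → M) where
  toFun g :=
    { toFun := fun f σ => f (g⁻¹ * σ)
      map_zero' := rfl
      map_add' := fun _ _ => rfl }
  map_one' := by ext f σ; exact congrArg f (by simp)
  map_mul' g g' := by ext f σ; exact congrArg f (by simp [mul_assoc])

namespace IsTotallyRamified

variable (ht : IsTotallyRamified B L H)
include ht

/-- The conjugates of `z` are independent modulo `𝔪 ^ (b + |H|)` over the fixed ring. -/
theorem forall_mem_maximalIdeal_of_sum_mem {p : ℕ} [Fact p.Prime] (hH : IsPGroup p H)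
    (hp : (p : B) ∈ IsLocalRing.maximalIdeal B) {b : ℤ} {z : L} (hz : z ∈ powSubmodule B L b)
    (hz0 : trace H z ≠ 0) (hzt : ord B (trace H z) = b + Fintype.card H - 1)
    {c : H → B} (hc : ∀ σ τ : H, τ • c σ = c σ)
    (hsum : ∑ σ : H, algebraMap B L (c σ) * σ • z ∈ powSubmodule B L (b + Fintype.card H)) :
    ∀ σ, c σ ∈ IsLocalRing.maximalIdeal B := by
  by_contra! hcon
  obtain ⟨σ₀, hσ₀⟩ := hcon
  -- `T` collects the residues of all relations. It is stable under translation by the `p`-group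
  -- `H`, so if nonzero it contains a nonzero constant function.
  let T : AddSubgroup (H → IsLocalRing.ResidueField B) :=
    { carrier := {f | ∃ c : H → B, (∀ σ τ : H, τ • c σ = c σ) ∧
        (∀ σ, IsLocalRing.residue B (c σ) = f σ) ∧
        ∑ σ : H, algebraMap B L (c σ) * σ • z ∈ powSubmodule B L (b + Fintype.card H)}
      zero_mem' := ⟨0, by simp, by simp, by simp⟩
      add_mem' := by
        rintro f f' ⟨c, h1, h2, h3⟩ ⟨c', h1', h2', h3'⟩
        refine ⟨c + c', fun σ τ => ?_, fun σ => ?_, ?_⟩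
        · simp [h1 σ τ, h1' σ τ]
        · simp [h2, h2']
        · simp only [Pi.add_apply, map_add, add_mul, Finset.sum_add_distrib]
          exact Submodule.add_mem _ h3 h3'
      neg_mem' := by
        rintro f ⟨c, h1, h2, h3⟩
        refine ⟨-c, fun σ τ => ?_, fun σ => ?_, ?_⟩
        · simp [h1 σ τ]
        · simp [h2]
        · simp only [Pi.neg_apply, map_neg, neg_mul, Finset.sum_neg_distrib]
          exact Submodule.neg_mem _ h3 }
  have hT : ∀ g, ∀ f ∈ T, leftTranslation H _ g f ∈ T := by
    rintro g f ⟨c, h1, h2, h3⟩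
    refine ⟨fun σ => c (g⁻¹ * σ), fun σ τ => h1 _ _, fun σ => h2 _, ?_⟩
    have h4 := smul_mem_powSubmodule g h3
    rw [Finset.smul_sum] at h4
    convert h4 using 1
    refine Fintype.sum_bijective (g⁻¹ * ·) (Group.mulLeft_bijective _) _ _ fun σ => ?_
    rw [smul_mul', ← algebraMap.smul', h1, smul_smul, mul_inv_cancel_left]
  have hpl : (p : IsLocalRing.ResidueField B) = 0 := by
    rw [← map_natCast (IsLocalRing.residue B), IsLocalRing.residue_eq_zero_iff]
    exact hp
  obtain ⟨f, ⟨c', h1, h2, h3⟩, hf0, hfix⟩ := exists_fixed_ne_zero_of_isPGroup hH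
    (leftTranslation H (IsLocalRing.ResidueField B))
    (fun f => by ext σ; simp [hpl]) T hT (x := fun σ => IsLocalRing.residue B (c σ))
    ⟨c, hc, fun _ => rfl, hsum⟩
    (fun h => hσ₀ ((IsLocalRing.residue_eq_zero_iff _).1 (congrFun h σ₀)))
  have hconst : ∀ σ, f σ = f 1 := by
    intro σ
    have h : f (σ⁻¹ * σ) = f σ := congrFun (hfix σ) σ
    rw [inv_mul_cancel] at h
    exact h.symm
  have hf1 : f 1 ≠ 0 := fun h => hf0 (funext fun σ => (hconst σ).trans h)
  -- Fixed elements of `𝔪` lie in `𝔪 ^ |H|`, so the coefficients may all be replaced by `c' 1`. What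
  -- remains is a unit times `trace H z`, of valuation `b + |H| - 1`, one too small.
  have hdiff : ∑ σ : H, algebraMap B L (c' σ - c' 1) * σ • z ∈
      powSubmodule B L (b + Fintype.card H) := by
    refine Submodule.sum_mem _ fun σ _ => ?_
    have h4 : c' σ - c' 1 ∈ IsLocalRing.maximalIdeal B := by
      rw [← IsLocalRing.residue_eq_zero_iff, map_sub, h2, h2, hconst, sub_self]
    rw [← algebraMap_mem_powSubmodule_one (L := L)] at h4
    have h5 := ht.mem_of_mem_add_one (x := algebraMap B L (c' σ - c' 1)) (n := 0)
      (fun τ => by rw [← algebraMap.smul', smul_sub, h1, h1]) h4 (by simp)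
    rw [add_comm]
    refine mul_mem_powSubmodule ?_ (smul_mem_powSubmodule σ hz)
    simpa using h5
  have h6 := Submodule.sub_mem _ h3 hdiff
  rw [← Finset.sum_sub_distrib] at h6
  simp only [map_sub, sub_mul, sub_sub_cancel] at h6
  rw [← Finset.mul_sum] at h6
  change algebraMap B L (c' 1) * trace H z ∈ _ at h6
  have hu : IsUnit (c' 1) := by
    rw [← IsLocalRing.residue_ne_zero_iff_isUnit, h2]; exact hf1
  obtain ⟨u, hu⟩ := hu
  have hu0 : algebraMap B L (u : B) ≠ 0 := by simp
  have h7 : ord B (algebraMap B L (u : B)) = 0 := by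
    simpa using ord_unit_mul_zpow (L := L) u 0
  rw [← hu, mem_powSubmodule_iff_ord (mul_ne_zero hu0 hz0), ord_mul hu0 hz0, h7, hzt] at h6
  omega

/-- Start from a crude lower bound for the coefficients and improve it by `|H|` at a time: after
rescaling by a power of the norm of `Π`, each improvement is `forall_mem_maximalIdeal_of_sum_mem`.
-/
theorem forall_mem_of_sum_smul_mem {p : ℕ} [Fact p.Prime] (hH : IsPGroup p H)
    (hp : (p : B) ∈ IsLocalRing.maximalIdeal B) {b : ℤ} {z : L} (hz : z ∈ powSubmodule B L b)
    (hz0 : trace H z ≠ 0) (hzt : ord B (trace H z) = b + Fintype.card H - 1)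
    {c : H → L} (hc : ∀ σ τ : H, τ • c σ = c σ) {m : ℤ}
    (hsum : ∑ σ : H, c σ * σ • z ∈ powSubmodule B L (b + Fintype.card H * m)) :
    ∀ σ, c σ ∈ powSubmodule B L (Fintype.card H * m) := by
  have hpos : (0 : ℤ) < Fintype.card H := by exact_mod_cast Fintype.card_pos
  have hν := normUnif_ne_zero (B := B) (L := L) (H := H)
  obtain ⟨N, hNm, hN⟩ : ∃ N : ℤ, N ≤ m ∧ ∀ σ, c σ ∈ powSubmodule B L (Fintype.card H * N) := by
    choose n hn using fun σ => exists_mem_powSubmodule (B := B) (c σ)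
    obtain ⟨n₀, hn₀⟩ : ∃ n₀ : ℤ, ∀ σ, n₀ ≤ n σ := by
      obtain ⟨n₀, hn₀⟩ := (Set.finite_range n).bddBelow
      exact ⟨n₀, fun σ => hn₀ ⟨σ, rfl⟩⟩
    refine ⟨min m (min n₀ 0), min_le_left _ _, fun σ => powSubmodule_anti ?_ (hn σ)⟩
    have h1 : min m (min n₀ 0) ≤ n₀ := (min_le_right _ _).trans (min_le_left _ _)
    have h2 : min m (min n₀ 0) ≤ 0 := (min_le_right _ _).trans (min_le_right _ _)
    have h3 := hn₀ σ
    nlinarith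
  induction m, hNm using Int.leInduction with
  | base => exact hN
  | succ m hm ih =>
    have hmem := ih (powSubmodule_anti (by nlinarith) hsum)
    have hscale : ∀ σ, ∃ y : B, algebraMap B L y = normUnif B L H ^ (-m) * c σ := by
      intro σ
      rw [← mem_powSubmodule_zero, mul_mem_powSubmodule_iff (zpow_ne_zero _ hν),
        ord_normUnif_zpow]
      convert hmem σ using 2
      ring
    choose y hy using hscale
    have hyfix : ∀ σ τ : H, τ • y σ = y σ := by
      intro σ τ
      apply IsFractionRing.injective B L
      rw [algebraMap.smul', hy, smul_mul', smul_normUnif_zpow, hc]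
    have hysum : ∑ σ : H, algebraMap B L (y σ) * σ • z ∈ powSubmodule B L (b + Fintype.card H) := by
      simp only [hy, mul_assoc]
      rw [← Finset.mul_sum, mul_mem_powSubmodule_iff (zpow_ne_zero _ hν), ord_normUnif_zpow]
      convert hsum using 2
      ring
    have h1 := ht.forall_mem_maximalIdeal_of_sum_mem hH hp hz hz0 hzt hyfix hysum
    intro σ
    have h2 := algebraMap_mem_powSubmodule_one (L := L).2 (h1 σ)
    rw [hy, mul_mem_powSubmodule_iff (zpow_ne_zero _ hν), ord_normUnif_zpow] at h2
    exact ht.mem_of_mem_add_one (hc σ) h2 (by linarith)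

/-- The conjugates of `z` form a normal basis of `L` over the fixed field. -/
theorem exists_sum_smul_eq [FaithfulSMul H L] {p : ℕ} [Fact p.Prime] (hH : IsPGroup p H)
    (hp : (p : B) ∈ IsLocalRing.maximalIdeal B) {b : ℤ} {z : L} (hz : z ∈ powSubmodule B L b)
    (hz0 : trace H z ≠ 0) (hzt : ord B (trace H z) = b + Fintype.card H - 1) (x : L) :
    ∃ c : H → L, (∀ σ τ : H, τ • c σ = c σ) ∧ x = ∑ σ : H, c σ * σ • z := by
  have hpos : (0 : ℤ) < Fintype.card H := by exact_mod_cast Fintype.card_pos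
  let F := FixedPoints.subfield H L
  have hli : LinearIndependent F fun σ : H => σ • z := by
    rw [Fintype.linearIndependent_iff]
    intro g hg σ
    -- A vanishing sum lies in every power of `𝔪`, hence so do its coefficients.
    refine Subtype.ext (eq_zero_of_forall_mem (B := B) fun n => ⟨Fintype.card H * max n 0, ?_, ?_⟩)
    · have h1 : n ≤ max n 0 := le_max_left _ _
      have h2 : 0 ≤ max n 0 := le_max_right _ _
      nlinarith
    · refine ht.forall_mem_of_sum_smul_mem hH hp hz hz0 hzt (c := fun σ => (g σ : L))
        (fun σ τ => (g σ).2 τ) ?_ σ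
      simp only [Subfield.smul_def, smul_eq_mul] at hg
      rw [hg]
      exact zero_mem _
  have hspan := hli.span_eq_top_of_card_eq_finrank' (FixedPoints.finrank_eq_card H L).symm
  have hx : x ∈ Submodule.span F (Set.range fun σ : H => σ • z) := hspan ▸ Submodule.mem_top
  obtain ⟨g, hg⟩ := (Submodule.mem_span_range_iff_exists_fun F).1 hx
  refine ⟨fun σ => (g σ : L), fun σ τ => (g σ).2 τ, ?_⟩
  rw [← hg]
  simp only [Subfield.smul_def, smul_eq_mul]

/-- In the weakly ramified case, elements of `𝔪 ^ b` are congruent, modulo the augmentation of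
`H`, to elements whose valuation is congruent to `b` modulo `|H|`. -/
theorem exists_eq_sum_smul_of_weaklyRamified [FaithfulSMul H L] {p : ℕ} [Fact p.Prime]
    (hH : IsPGroup p H) (hp : (p : B) ∈ IsLocalRing.maximalIdeal B)
    (hδ : ord B (differentElement B L H) = (Fintype.card H - 1) * 2) {b : ℤ}
    (hb : b ≡ 1 [ZMOD Fintype.card H]) {i : ℤ} (hbi : b ≤ i)
    (hi : ¬ i ≡ b [ZMOD Fintype.card H]) {x : L} (hx : x ∈ powSubmodule B L i) :
    ∃ w : H → L, (∀ σ, w σ ∈ powSubmodule B L b) ∧ x = ∑ σ : H, σ • w σ ∧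
      ∑ σ : H, w σ ∈ powSubmodule B L (i + 1) := by
  have hpos : 0 < Fintype.card H := Fintype.card_pos
  have hcast : ((Fintype.card H - 1 : ℕ) : ℤ) = Fintype.card H - 1 := by push_cast [hpos]; rfl
  have hδ0 := ht.differentElement_ne_zero
  have hπ := unifL_ne_zero B L
  obtain ⟨q, hq⟩ := (Int.modEq_iff_dvd).1 hb.symm
  -- As `b = 1 + |H| q`, the fixed element `ν` has valuation `b + |H| - 1`. Dividing `ν Π ^ (|H| -
  -- 1)` by `δ`, of valuation `2 (|H| - 1)`, leaves valuation exactly `b`.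
  set ν := normUnif B L H ^ (q + 1) with hν
  have hν0 : ν ≠ 0 := zpow_ne_zero _ normUnif_ne_zero
  set z := ν * unifL B L ^ (Fintype.card H - 1) / differentElement B L H with hzdef
  have htz : trace H z = ν := ht.trace_mul_pow_div fun σ => smul_normUnif_zpow σ _
  have hordν : ord B ν = b + Fintype.card H - 1 := by
    rw [hν, ord_normUnif_zpow]; linarith
  have hz0' : z ≠ 0 := div_ne_zero (mul_ne_zero hν0 (pow_ne_zero _ hπ)) hδ0
  have hordz : ord B z = b := by
    rw [hzdef, ord_div (mul_ne_zero hν0 (pow_ne_zero _ hπ)) hδ0, ord_mul hν0 (pow_ne_zero _ hπ),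
      ord_pow hπ, ord_unifL, hδ, hordν, hcast]
    ring
  have hz : z ∈ powSubmodule B L b := (mem_powSubmodule_iff_ord hz0').2 hordz.ge
  have hz0 : trace H z ≠ 0 := htz ▸ hν0
  have hzt : ord B (trace H z) = b + Fintype.card H - 1 := htz ▸ hordν
  obtain ⟨c, hc, hxc⟩ := ht.exists_sum_smul_eq hH hp hz hz0 hzt x
  have hcmem := ht.forall_mem_of_sum_smul_mem hH hp hz hz0 hzt hc (m := 0)
    (hxc ▸ powSubmodule_anti (by simpa using hbi) hx)
  rw [mul_zero] at hcmem
  refine ⟨fun σ => c σ * z, fun σ => ?_, ?_, ?_⟩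
  · rw [← zero_add b]
    exact mul_mem_powSubmodule (hcmem σ) hz
  · rw [hxc]
    exact Finset.sum_congr rfl fun σ _ => by rw [smul_mul', hc]
  · rw [← Finset.sum_mul]
    set C := ∑ σ, c σ with hC
    have hCfix : ∀ τ : H, τ • C = C := fun τ => by
      rw [hC, Finset.smul_sum]
      exact Finset.sum_congr rfl fun σ _ => hc σ τ
    have htx : trace H x = C * ν := by
      rw [hxc, trace_sum, hC, Finset.sum_mul]
      exact Finset.sum_congr rfl fun σ _ => by rw [trace_mul_of_fixed (hc σ), trace_smul, htz]
    have h1 := ht.trace_mul_pow_mem hx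
    by_cases hC0 : C = 0
    · simp [hC0]
    rw [htx, hδ, mem_powSubmodule_iff_ord (mul_ne_zero (mul_ne_zero hC0 hν0) (pow_ne_zero _ hπ)),
      ord_mul (mul_ne_zero hC0 hν0) (pow_ne_zero _ hπ), ord_mul hC0 hν0, hordν, ord_pow hπ,
      ord_unifL, hcast] at h1
    rw [mem_powSubmodule_iff_ord (mul_ne_zero hC0 hz0'), ord_mul hC0 hz0', hordz]
    -- The trace estimate gives `v(C) + b ≥ i`. Equality is excluded because `v(C)` is a multiple of
    -- `|H|`, and this gains the extra power of `𝔪`.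
    have h2 : ord B C + b ≠ i := by
      intro h
      refine hi ((Int.modEq_iff_dvd).2 ?_).symm.symm
      have := ht C hCfix
      rw [← h]
      simpa using this
    have h3 : i ≤ ord B C + b := by linarith
    omega

end IsTotallyRamified

end TotallyRamified
end DVRExtension

/-! ### A criterion for cyclic modules over finite-dimensional algebras -/

section CyclicModules

universe u

open Module

variable {k Λ : Type*} [Field k] [Ring Λ] [Algebra k Λ]

instance LinearMap.finite_of_isScalarTower {X E : Type*} [AddCommGroup X] [Module k X] [Module Λ X]
    [IsScalarTower k Λ X] [Module.Finite k X] [AddCommGroup E] [Module k E] [Module Λ E]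
    [IsScalarTower k Λ E] [Module.Finite k E] : Module.Finite k (X →ₗ[Λ] E) :=
  Module.Finite.of_injective (LinearMap.restrictScalarsₗ k Λ X E k)
    (LinearMap.restrictScalars_injective k)

theorem finrank_hom_of_isCompl {X E : Type*} [AddCommGroup X] [Module k X] [Module Λ X]
    [IsScalarTower k Λ X] [Module.Finite k X] [AddCommGroup E] [Module k E] [Module Λ E]
    [IsScalarTower k Λ E] [Module.Finite k E] {p q : Submodule Λ X} (h : IsCompl p q) :
    finrank k (X →ₗ[Λ] E) = finrank k (p →ₗ[Λ] E) + finrank k (q →ₗ[Λ] E) := by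
  have : Module.Finite k p := inferInstanceAs (Module.Finite k (p.restrictScalars k))
  have : Module.Finite k q := inferInstanceAs (Module.Finite k (q.restrictScalars k))
  rw [← finrank_prod]
  refine LinearEquiv.finrank_eq ?_
  exact ((Submodule.prodEquivOfIsCompl p q h).symm.congrLeft E k).trans
    (LinearMap.coprodEquiv (R := Λ) k).symm

/-- A semisimple module `X` is a quotient of a semisimple module `Y` if the multiplicities of
simple modules in `X` are at most those in `Y`. -/
theorem exists_surjective_of_finrank_hom_le {X : Type u} {Y : Type*} [AddCommGroup X] [Module k X]
    [Module Λ X] [IsScalarTower k Λ X] [Module.Finite k X] [IsSemisimpleModule Λ X]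
    [AddCommGroup Y] [Module k Y] [Module Λ Y] [IsScalarTower k Λ Y] [Module.Finite k Y]
    [IsSemisimpleModule Λ Y]
    (h : ∀ (E : Type u) [AddCommGroup E] [Module k E] [Module Λ E] [IsScalarTower k Λ E]
      [Module.Finite k E] [IsSimpleModule Λ E],
      finrank k (X →ₗ[Λ] E) ≤ finrank k (Y →ₗ[Λ] E)) :
    ∃ f : Y →ₗ[Λ] X, Function.Surjective f := by
  induction hn : finrank k X using Nat.strong_induction_on generalizing X Y with
  | _ n ih =>
    rcases subsingleton_or_nontrivial X with hX | hX
    · exact ⟨0, fun x => ⟨0, Subsingleton.elim _ _⟩⟩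
    obtain ⟨m, hm⟩ := IsSemisimpleModule.exists_simple_submodule Λ X
    obtain ⟨c, hc⟩ := exists_isCompl m
    have : Module.Finite k m := inferInstanceAs (Module.Finite k (m.restrictScalars k))
    have : Module.Finite k c := inferInstanceAs (Module.Finite k (c.restrictScalars k))
    have hmk : 0 < finrank k m := by
      have := IsSimpleModule.nontrivial Λ m
      exact finrank_pos
    have hclt : finrank k c < n := by
      have h1 := ((Submodule.prodEquivOfIsCompl m c hc).restrictScalars k).finrank_eq
      rw [finrank_prod] at h1
      omega
    have hpos : 0 < finrank k (Y →ₗ[Λ] m) := by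
      refine lt_of_lt_of_le ?_ (h m)
      rw [finrank_hom_of_isCompl hc]
      have : Nontrivial (m →ₗ[Λ] m) := by
        have := IsSimpleModule.nontrivial Λ m
        infer_instance
      have := finrank_pos (R := k) (M := m →ₗ[Λ] m)
      omega
    have hnt : Nontrivial (Y →ₗ[Λ] m) := nontrivial_of_finrank_pos hpos
    obtain ⟨g, hg⟩ := exists_ne (0 : Y →ₗ[Λ] m)
    have hgs := LinearMap.surjective_of_ne_zero hg
    -- Split off a copy of the simple module `m` from both `X` and `Y`. Every `Hom` dimension drops
    -- by the same amount, so the hypothesis passes to `c` and `ker g`.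
    obtain ⟨d, hd⟩ := exists_isCompl (LinearMap.ker g)
    have : Module.Finite k (LinearMap.ker g) :=
      inferInstanceAs (Module.Finite k ((LinearMap.ker g).restrictScalars k))
    let e : d ≃ₗ[Λ] m := (Submodule.quotientEquivOfIsCompl _ d hd).symm.trans
      (g.quotKerEquivOfSurjective hgs)
    obtain ⟨φ, hφ⟩ := ih _ hclt (X := c) (Y := LinearMap.ker g) (by
      intro E _ _ _ _ _ _
      have h1 := h E
      rw [finrank_hom_of_isCompl hc, finrank_hom_of_isCompl hd,
        (e.congrLeft E k).finrank_eq] at h1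
      omega) rfl
    obtain ⟨pr, hpr⟩ := IsSemisimpleModule.extension_property (LinearMap.ker g).subtype
      Subtype.val_injective φ
    refine ⟨c.subtype ∘ₗ pr + m.subtype ∘ₗ g, fun x => ?_⟩
    obtain ⟨⟨a, b⟩, rfl⟩ := (Submodule.prodEquivOfIsCompl m c hc).surjective x
    obtain ⟨y, rfl⟩ := hgs a
    obtain ⟨y', hy'⟩ := hφ (b - pr y)
    refine ⟨y + y', ?_⟩
    have h1 : pr y' = b - pr y := by
      rw [← hy', ← hpr]; rfl
    have h2 : g y' = 0 := y'.2
    simp [h1, h2, add_comm]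

/-- A finite-dimensional module `V` over a finite-dimensional algebra `Λ` is cyclic if
`dim Hom (V, E) ≤ dim E` for all simple modules `E`. -/
theorem exists_span_singleton_eq_top_of_finrank_hom_le [Module.Finite k Λ] {V : Type u}
    [AddCommGroup V] [Module k V] [Module Λ V] [IsScalarTower k Λ V] [Module.Finite k V]
    (h : ∀ (E : Type u) [AddCommGroup E] [Module k E] [Module Λ E] [IsScalarTower k Λ E]
      [Module.Finite k E] [IsSimpleModule Λ E], finrank k (V →ₗ[Λ] E) ≤ finrank k E) :
    ∃ v : V, Submodule.span Λ {v} = ⊤ := by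
  have hartΛ : IsArtinian Λ Λ := isArtinian_of_tower k inferInstance
  have hartV : IsArtinian Λ V := isArtinian_of_tower k inferInstance
  have : Module.Finite Λ V := Module.Finite.of_restrictScalars_finite k Λ V
  let JV := Module.jacobson Λ V
  let JΛ := Module.jacobson Λ Λ
  have hX : IsSemisimpleModule Λ (V ⧸ JV) :=
    (IsArtinian.isSemisimpleModule_iff_jacobson Λ _).2 (Module.jacobson_quotient_jacobson Λ V)
  have hY : IsSemisimpleModule Λ (Λ ⧸ JΛ) :=
    (IsArtinian.isSemisimpleModule_iff_jacobson Λ _).2 (Module.jacobson_quotient_jacobson Λ Λ)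
  have : Module.Finite k (V ⧸ JV) :=
    Module.Finite.of_surjective (JV.mkQ.restrictScalars k) JV.mkQ_surjective
  have : Module.Finite k (Λ ⧸ JΛ) :=
    Module.Finite.of_surjective (JΛ.mkQ.restrictScalars k) JΛ.mkQ_surjective
  obtain ⟨f, hf⟩ := exists_surjective_of_finrank_hom_le (k := k) (Λ := Λ) (X := V ⧸ JV)
    (Y := Λ ⧸ JΛ) (by
      intro E _ _ _ _ _ _
      have h1 : finrank k ((V ⧸ JV) →ₗ[Λ] E) ≤ finrank k (V →ₗ[Λ] E) := by
        let F : ((V ⧸ JV) →ₗ[Λ] E) →ₗ[k] (V →ₗ[Λ] E) :=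
          { toFun := fun φ => φ ∘ₗ JV.mkQ
            map_add' := fun _ _ => rfl
            map_smul' := fun _ _ => rfl }
        refine LinearMap.finrank_le_finrank_of_injective (f := F) fun φ ψ hφ => ?_
        exact Submodule.linearMap_qext _ hφ
      -- The radical kills simple modules, so each `e : E` defines a map from `Λ ⧸ JΛ` sending the
      -- class of `1` to `e`.
      have h2 : finrank k E ≤ finrank k ((Λ ⧸ JΛ) →ₗ[Λ] E) := by
        have hE : ∀ e : E, JΛ ≤ LinearMap.ker (LinearMap.toSpanSingleton Λ E e) := by
          intro e
          have h3 := Module.le_comap_jacobson (LinearMap.toSpanSingleton Λ E e)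
          rwa [IsSimpleModule.jacobson_eq_bot Λ E, Submodule.comap_bot] at h3
        have hl : ∀ e, JΛ.liftQ (LinearMap.toSpanSingleton Λ E e) (hE e) (JΛ.mkQ 1) = e := by
          intro e
          rw [Submodule.mkQ_apply, Submodule.liftQ_apply, LinearMap.toSpanSingleton_apply, one_smul]
        let F : E →ₗ[k] ((Λ ⧸ JΛ) →ₗ[Λ] E) :=
          { toFun := fun e => JΛ.liftQ (LinearMap.toSpanSingleton Λ E e) (hE e)
            map_add' := fun a b => by
              refine Submodule.linearMap_qext _ (LinearMap.ext_ring ?_)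
              exact (hl _).trans (congrArg₂ (· + ·) (hl a) (hl b)).symm
            map_smul' := fun a b => by
              refine Submodule.linearMap_qext _ (LinearMap.ext_ring ?_)
              exact (hl _).trans (congrArg (a • ·) (hl b)).symm }
        refine LinearMap.finrank_le_finrank_of_injective (f := F) fun a b hab => ?_
        have := LinearMap.congr_fun hab (JΛ.mkQ 1)
        exact (hl a).symm.trans (this.trans (hl b))
      exact h1.trans ((h E).trans h2))
  obtain ⟨v, hv⟩ := JV.mkQ_surjective (f (JΛ.mkQ 1))
  refine ⟨v, ?_⟩
  by_contra hne
  -- A maximal submodule containing `v` also contains the radical `JV`, modulo which `v` generates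
  -- everything.
  obtain ⟨N, hN, hvN⟩ := (eq_top_or_exists_le_coatom (Submodule.span Λ {v})).resolve_left hne
  refine hN.1 (eq_top_iff.2 fun x _ => ?_)
  obtain ⟨y, hy⟩ := hf (JV.mkQ x)
  obtain ⟨a, rfl⟩ := JΛ.mkQ_surjective y
  have h1 : JV.mkQ (a • v) = JV.mkQ x := by
    rw [map_smul, hv, ← map_smul, ← map_smul, smul_eq_mul, mul_one, hy]
  have h2 : x - a • v ∈ JV := by
    rw [← Submodule.Quotient.eq]; exact h1.symm
  have h3 : JV ≤ N := sInf_le hN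
  have h4 : a • v ∈ N := N.smul_mem _ (hvN (Submodule.mem_span_singleton_self v))
  have := N.add_mem (h3 h2) h4
  rwa [sub_add_cancel] at this

end CyclicModules

/-! ### Galois descent and eigenspaces -/

section GaloisDescent

open Module

variable {k l W : Type*} [Field k] [Field l] [Algebra k l] [FiniteDimensional k l] [IsGalois k l]
  [AddCommGroup W] [Module k W] [Module l W] [IsScalarTower k l W]

/-- Galois descent: a family of vectors fixed by semilinear maps is linearly independent over `l`
as soon as it is so over `k`. -/
theorem LinearIndependent.of_forall_semilinear {ι : Type*} {w : ι → W}
    (hw : LinearIndependent k w)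
    (hS : ∀ γ : l ≃ₐ[k] l, ∃ S : W →+ W, (∀ (a : l) x, S (a • x) = γ a • S x) ∧
      ∀ i, S (w i) = w i) : LinearIndependent l w := by
  rw [linearIndependent_iff'] at hw ⊢
  intro s c hc i hi
  choose S hS1 hS2 using hS
  have key : ∀ ν : l, ∑ j ∈ s, (ν * c j) • w j = 0 := by
    intro ν
    simp_rw [mul_smul]
    rw [← Finset.smul_sum, hc, smul_zero]
  -- Multiply the relation by `ν` and sum its images under all `S γ`: the coefficients become
  -- traces, so independence over `k` applies. Nondegeneracy of the trace form then kills `c i`.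
  have htr : ∀ ν : l, Algebra.trace k l (ν * c i) = 0 := by
    intro ν
    refine hw s (fun j => Algebra.trace k l (ν * c j)) ?_ i hi
    have h1 : ∑ γ : l ≃ₐ[k] l, S γ (∑ j ∈ s, (ν * c j) • w j) = 0 := by
      simp [key]
    simp_rw [map_sum, hS1, hS2] at h1
    rw [Finset.sum_comm] at h1
    rw [← h1]
    refine Finset.sum_congr rfl fun j _ => ?_
    rw [← Finset.sum_smul, ← trace_eq_sum_automorphisms, algebraMap_smul]
  refine (traceForm_nondegenerate k l).1 (c i) fun ν => ?_
  rw [Algebra.traceForm_apply, mul_comm]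
  exact htr ν

theorem finrank_le_finrank_span_of_forall_semilinear [FiniteDimensional k W]
    (R : Submodule k W)
    (hS : ∀ γ : l ≃ₐ[k] l, ∃ S : W →+ W, (∀ (a : l) x, S (a • x) = γ a • S x) ∧
      ∀ x ∈ R, S x = x) : finrank k R ≤ finrank l (Submodule.span l (R : Set W)) := by
  have : Module.Finite l W := Module.Finite.of_restrictScalars_finite k l W
  let v := finBasis k R
  have hv : LinearIndependent k (fun i => (v i : W)) :=
    v.linearIndependent.map' R.subtype R.ker_subtype
  have hl : LinearIndependent l (fun i => (v i : W)) := by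
    refine hv.of_forall_semilinear fun γ => ?_
    obtain ⟨S, h1, h2⟩ := hS γ
    exact ⟨S, h1, fun i => h2 _ (v i).2⟩
  have h1 := finrank_span_eq_card hl
  rw [Fintype.card_fin] at h1
  rw [← h1]
  refine Submodule.finrank_mono (Submodule.span_mono ?_)
  rintro _ ⟨i, rfl⟩
  exact (v i).2

theorem Module.End.sum_finrank_eigenspace_le {l W ι : Type*} [Field l] [AddCommGroup W]
    [Module l W] [FiniteDimensional l W] (T : End l W) {a : ι → l} {s : Finset ι}
    (ha : Set.InjOn a s) : ∑ j ∈ s, finrank l (T.eigenspace (a j)) ≤ finrank l W := by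
  classical
  have h1 : ∑ j ∈ s, finrank l (T.eigenspace (a j)) =
      finrank l (s.sup fun j => T.eigenspace (a j) : Submodule l W) := by
    induction s using Finset.induction_on with
    | empty => rw [Finset.sum_empty, Finset.sup_empty, finrank_bot]
    | insert i s hi ih =>
      rw [Finset.sum_insert hi, Finset.sup_insert, ih (ha.mono (by simp)),
        ← Submodule.finrank_sup_add_finrank_inf_eq]
      have hd : Disjoint (T.eigenspace (a i)) (s.sup fun j => T.eigenspace (a j)) := by
        refine (T.eigenspaces_iSupIndep (a i)).mono_right ?_
        refine Finset.sup_le fun j hj => ?_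
        refine le_iSup₂_of_le (a j) (fun h => hi ?_) le_rfl
        exact ha (by simp [hj]) (by simp) h ▸ hj
      rw [hd.eq_bot, finrank_bot, add_zero]
  rw [h1]
  exact Submodule.finrank_le _

/-- Descent bounds each `k`-dimension by that of the `l`-span, and these spans lie in eigenspaces of
`T` for distinct eigenvalues. -/
theorem sum_finrank_le_of_forall_semilinear [FiniteDimensional k W] {ι : Type*} {s : Finset ι}
    (R : ι → Submodule k W)
    (hS : ∀ j ∈ s, ∀ γ : l ≃ₐ[k] l, ∃ S : W →+ W, (∀ (a : l) x, S (a • x) = γ a • S x) ∧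
      ∀ x ∈ R j, S x = x)
    (T : End l W) {a : ι → l} (ha : Set.InjOn a s) (hT : ∀ j ∈ s, ∀ x ∈ R j, T x = a j • x) :
    ∑ j ∈ s, finrank k (R j) ≤ finrank l W := by
  have : Module.Finite l W := Module.Finite.of_restrictScalars_finite k l W
  refine le_trans (Finset.sum_le_sum fun j hj => ?_) (T.sum_finrank_eigenspace_le ha)
  refine (finrank_le_finrank_span_of_forall_semilinear (R j) (hS j hj)).trans
    (Submodule.finrank_mono (Submodule.span_le.2 fun x hx => ?_))
  exact Module.End.mem_eigenspace_iff.2 (hT j hj x hx)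

end GaloisDescent

/-! ### The space of k-linear maps from l to E -/

section Coextension

open Module

/-- The `k`-linear maps from `l` to `E`, as a vector space over `l`. -/
def Coextension (k l E : Type*) [Field k] [Field l] [Algebra k l] [AddCommGroup E] [Module k E] :
    Type _ := l →ₗ[k] E

namespace Coextension

variable {k l E : Type*} [Field k] [Field l] [Algebra k l] [AddCommGroup E] [Module k E]

noncomputable instance : AddCommGroup (Coextension k l E) :=
  inferInstanceAs (AddCommGroup (l →ₗ[k] E))

noncomputable instance : Module k (Coextension k l E) := inferInstanceAs (Module k (l →ₗ[k] E))

instance : FunLike (Coextension k l E) l E := inferInstanceAs (FunLike (l →ₗ[k] E) l E)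

@[ext]
theorem ext {ψ ψ' : Coextension k l E} (h : ∀ μ, ψ μ = ψ' μ) : ψ = ψ' := DFunLike.ext _ _ h

noncomputable instance : Module l (Coextension k l E) where
  smul a ψ := LinearMap.comp (show l →ₗ[k] E from ψ) (LinearMap.mulLeft k a)
  one_smul ψ := ext fun μ => congrArg ψ (one_mul μ)
  mul_smul a b ψ := ext fun μ => congrArg ψ (show a * b * μ = b * (a * μ) by ring)
  smul_zero a := ext fun μ => rfl
  smul_add a ψ ψ' := ext fun μ => rfl
  add_smul a b ψ := ext fun μ => by
    change (show l →ₗ[k] E from ψ) ((a + b) * μ) = (show l →ₗ[k] E from ψ) (a * μ) +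
      (show l →ₗ[k] E from ψ) (b * μ)
    rw [add_mul, map_add]
  zero_smul ψ := ext fun μ => by
    change (show l →ₗ[k] E from ψ) (0 * μ) = 0
    rw [zero_mul, map_zero]

theorem smul_apply (a : l) (ψ : Coextension k l E) (μ : l) : (a • ψ) μ = ψ (a * μ) := rfl

theorem add_apply (ψ ψ' : Coextension k l E) (μ : l) : (ψ + ψ') μ = ψ μ + ψ' μ := rfl

instance : IsScalarTower k l (Coextension k l E) where
  smul_assoc c a ψ := ext fun μ => by
    change (show l →ₗ[k] E from ψ) ((c • a) * μ) = c • (show l →ₗ[k] E from ψ) (a * μ)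
    rw [smul_mul_assoc, map_smul]

instance [FiniteDimensional k l] [FiniteDimensional k E] :
    FiniteDimensional k (Coextension k l E) := inferInstanceAs (Module.Finite k (l →ₗ[k] E))

theorem finrank_eq [FiniteDimensional k l] [FiniteDimensional k E] :
    finrank l (Coextension k l E) = finrank k E := by
  have h1 : finrank k (Coextension k l E) = finrank k l * finrank k E :=
    Module.finrank_linearMap k k l E
  rw [← Module.finrank_mul_finrank k l (Coextension k l E)] at h1
  exact Nat.eq_of_mul_eq_mul_left finrank_pos h1

/-- The `l`-linear endomorphism of `Coextension k l E` given by composition with a `k`-linear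
endomorphism of `E`. -/
noncomputable def postcomp (ρ : E →ₗ[k] E) : End l (Coextension k l E) where
  toFun ψ := LinearMap.comp ρ (show l →ₗ[k] E from ψ)
  map_add' _ _ := ext fun _ => map_add ρ _ _
  map_smul' _ _ := rfl

/-- The additive endomorphism `ψ ↦ ρ ∘ ψ ∘ θ` of `Coextension k l E`. -/
noncomputable def conj (ρ : E →ₗ[k] E) (θ : l →ₗ[k] l) :
    Coextension k l E →+ Coextension k l E where
  toFun ψ := ρ.comp ((show l →ₗ[k] E from ψ).comp θ)
  map_zero' := ext fun _ => map_zero ρ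
  map_add' _ _ := ext fun _ => map_add ρ _ _

theorem conj_apply (ρ : E →ₗ[k] E) (θ : l →ₗ[k] l) (ψ : Coextension k l E) (μ : l) :
    conj ρ θ ψ μ = ρ (ψ (θ μ)) := rfl

end Coextension

end Coextension

/-! ### The bound on equivariant maps -/

namespace DVRExtension

section HomBound

open IsLocalRing Module

variable {A B L G E X : Type*} [CommRing A] [IsLocalRing A] [CommRing B] [IsDomain B]
  [IsDiscreteValuationRing B] [Algebra A B] [IsLocalHom (algebraMap A B)] [Field L] [Algebra B L]
  [IsFractionRing B L] [Group G] [MulSemiringAction G B] [MulSemiringAction G L]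
  [SMulDistribClass G B L] [AddCommGroup E] [Module (ResidueField A) E] [AddCommGroup X]
  [Module (ResidueField A) X]

/-- The linear map `ev` realizes `X` as a space of `A`-linear equivariant maps from the `b`-th power
of the maximal ideal of `B` to the representation `E`. -/
structure IsEquivariantEval (ρ : Representation (ResidueField A) G E) (b : ℤ)
    (ev : X →ₗ[ResidueField A] L → E) : Prop where
  map_add : ∀ f, ∀ x ∈ powSubmodule B L b, ∀ y ∈ powSubmodule B L b,
    ev f (x + y) = ev f x + ev f y
  map_mul : ∀ f (a : A), ∀ x ∈ powSubmodule B L b,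
    ev f (algebraMap B L (algebraMap A B a) * x) = residue A a • ev f x
  map_smul : ∀ f (g : G), ∀ x ∈ powSubmodule B L b, ev f (g • x) = ρ g (ev f x)
  eq_zero : ∀ f, (∀ x ∈ powSubmodule B L b, ev f x = 0) → f = 0

variable (B) in
/-- The elements of `X` that vanish on the `i`-th power of the maximal ideal of `B`. -/
def vanishing (ev : X →ₗ[ResidueField A] L → E) (i : ℤ) : Submodule (ResidueField A) X where
  carrier := {f | ∀ x ∈ powSubmodule B L i, ev f x = 0}
  add_mem' := fun hf hg x hx => by
    rw [_root_.map_add, Pi.add_apply, hf x hx, hg x hx, add_zero]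
  zero_mem' := fun x _ => by rw [map_zero, Pi.zero_apply]
  smul_mem' := fun c f hf x hx => by
    rw [LinearMap.map_smul, Pi.smul_apply, hf x hx, smul_zero]

theorem mem_vanishing {ev : X →ₗ[ResidueField A] L → E} {i : ℤ} {f : X} :
    f ∈ vanishing B ev i ↔ ∀ x ∈ powSubmodule B L i, ev f x = 0 := Iff.rfl

theorem algebraMap_mul_unifL_zpow_mem (c : B) (i : ℤ) :
    algebraMap B L c * unifL B L ^ i ∈ powSubmodule B L i := mem_powSubmodule.2 ⟨c, rfl⟩

theorem algebraMap_mul_unifL_zpow_mem_add_one {c : B} (hc : residue B c = 0) (i : ℤ) :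
    algebraMap B L c * unifL B L ^ i ∈ powSubmodule B L (i + 1) := by
  rw [residue_eq_zero_iff, (irreducible_unif B).maximalIdeal_eq, Ideal.mem_span_singleton'] at hc
  obtain ⟨d, rfl⟩ := hc
  refine mem_powSubmodule.2 ⟨d, ?_⟩
  rw [zpow_add₀ (unifL_ne_zero B L), map_mul, zpow_one, ← unifL]
  ring

namespace IsEquivariantEval

variable {ρ : Representation (ResidueField A) G E} {b : ℤ} {ev : X →ₗ[ResidueField A] L → E}
  (h : IsEquivariantEval (B := B) ρ b ev)
include h

theorem eval_congr {i : ℤ} (hi : b ≤ i) {f : X} (hf : f ∈ vanishing B ev (i + 1)) {x y : L}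
    (hy : y ∈ powSubmodule B L i) (hxy : x - y ∈ powSubmodule B L (i + 1)) :
    ev f x = ev f y := by
  have h1 := h.map_add f (x - y) (powSubmodule_anti (by omega) hxy) y (powSubmodule_anti hi hy)
  rwa [sub_add_cancel, hf _ hxy, zero_add] at h1

theorem eval_congr_residue {i : ℤ} (hi : b ≤ i) {f : X} (hf : f ∈ vanishing B ev (i + 1)) {c d : B}
    (hcd : residue B c = residue B d) :
    ev f (algebraMap B L c * unifL B L ^ i) = ev f (algebraMap B L d * unifL B L ^ i) := by
  refine h.eval_congr hi hf (algebraMap_mul_unifL_zpow_mem d i) ?_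
  rw [← sub_mul, ← map_sub]
  exact algebraMap_mul_unifL_zpow_mem_add_one (by rw [map_sub, hcd, sub_self]) i

/-- Multiplication by `Π ^ i` identifies the residue field of `B` with the `i`-th graded piece.
Residues are lifted arbitrarily; by `eval_congr_residue` the value does not depend on the lift,
which yields linearity. -/
theorem exists_gradedMap {i : ℤ} (hi : b ≤ i) :
    ∃ D : vanishing B ev (i + 1) →ₗ[ResidueField A]
      Coextension (ResidueField A) (ResidueField B) E,
      ∀ f (c : B), D f (residue B c) = ev f (algebraMap B L c * unifL B L ^ i) := by
  have hsr : ∀ μ, residue B (Function.surjInv residue_surjective μ) = μ :=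
    Function.surjInv_eq residue_surjective
  refine ⟨⟨⟨fun f => ⟨⟨fun μ => ev f (algebraMap B L (Function.surjInv residue_surjective μ) *
    unifL B L ^ i), ?_⟩, ?_⟩, ?_⟩, ?_⟩, ?_⟩
  · intro μ ν
    rw [← h.map_add _ _ (powSubmodule_anti hi (algebraMap_mul_unifL_zpow_mem _ i)) _
      (powSubmodule_anti hi (algebraMap_mul_unifL_zpow_mem _ i)), ← add_mul, ← _root_.map_add]
    exact h.eval_congr_residue hi f.2 (by simp only [_root_.map_add, hsr])
  · intro a μ
    obtain ⟨a, rfl⟩ := residue_surjective a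
    dsimp only
    rw [RingHom.id_apply, ← h.map_mul _ _ _
      (powSubmodule_anti hi (algebraMap_mul_unifL_zpow_mem _ i)), ← mul_assoc, ← _root_.map_mul]
    exact h.eval_congr_residue hi f.2 (by
      rw [hsr, _root_.map_mul, hsr, Algebra.smul_def]; rfl)
  · intro f g
    refine Coextension.ext fun μ => ?_
    change ev ((f + g : vanishing B ev (i + 1)) : X) _ = ev f _ + ev g _
    rw [Submodule.coe_add, _root_.map_add, Pi.add_apply]
  · intro a f
    refine Coextension.ext fun μ => ?_
    change ev ((a • f : vanishing B ev (i + 1)) : X) _ = a • ev f _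
    rw [Submodule.coe_smul, LinearMap.map_smul, Pi.smul_apply]
  · intro f c
    exact h.eval_congr_residue hi f.2 (hsr _)

/-- The map sending an element `f` of `X` that vanishes on the `i + 1`-st power of the maximal ideal
to the induced map on the `i`-th graded piece. -/
noncomputable def gradedMap {i : ℤ} (hi : b ≤ i) : vanishing B ev (i + 1) →ₗ[ResidueField A]
    Coextension (ResidueField A) (ResidueField B) E :=
  (h.exists_gradedMap hi).choose

theorem gradedMap_residue {i : ℤ} (hi : b ≤ i) (f : vanishing B ev (i + 1)) (c : B) :
    h.gradedMap hi f (residue B c) = ev f (algebraMap B L c * unifL B L ^ i) :=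
  (h.exists_gradedMap hi).choose_spec f c

theorem vanishing_mono {i j : ℤ} (hij : i ≤ j) : vanishing B ev i ≤ vanishing B ev j :=
  fun _ hf x hx => hf x (powSubmodule_anti hij hx)

theorem finrank_vanishing_add_one [FiniteDimensional (ResidueField A) X] {i : ℤ} (hi : b ≤ i) :
    finrank (ResidueField A) (vanishing B ev (i + 1)) =
      finrank (ResidueField A) (vanishing B ev i) +
        finrank (ResidueField A) (LinearMap.range (h.gradedMap hi)) := by
  rw [← LinearMap.finrank_range_add_finrank_ker (h.gradedMap hi), add_comm]
  congr 1
  have h1 : LinearMap.ker (h.gradedMap hi) =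
      (vanishing B ev i).comap (vanishing B ev (i + 1)).subtype := by
    ext f
    rw [LinearMap.mem_ker, Submodule.mem_comap, Submodule.subtype_apply, mem_vanishing]
    constructor
    · intro hf x hx
      obtain ⟨c, rfl⟩ := mem_powSubmodule.1 hx
      rw [← h.gradedMap_residue hi, hf]
      rfl
    · intro hf
      refine Coextension.ext fun μ => ?_
      obtain ⟨c, rfl⟩ := residue_surjective μ
      rw [h.gradedMap_residue hi]
      exact hf _ (algebraMap_mul_unifL_zpow_mem c i)
  rw [h1]
  exact (Submodule.comapSubtypeEquivOfLe (h.vanishing_mono (by omega))).finrank_eq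

/-- This is equivariance applied to `g (c Π ^ i) = g(c) u ^ i Π ^ i`. It supplies both the
semilinear symmetry and the tame eigenvalue used in `finrank_le`. -/
theorem map_gradedMap {i : ℤ} (hi : b ≤ i) (f : vanishing B ev (i + 1)) (g : G) {u : Bˣ}
    (hu : g • unifL B L = algebraMap B L u * unifL B L) (c : B) :
    ρ g (h.gradedMap hi f (residue B c)) =
      h.gradedMap hi f (residue B (g • c) * residue B u ^ i) := by
  have h1 : residue B (g • c) * residue B u ^ i = residue B (g • c * ((u ^ i : Bˣ) : B)) := by
    rw [_root_.map_mul]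
    congr 1
    have := map_zpow (Units.map (residue B : B →* ResidueField B)) u i
    have h2 := congrArg Units.val this
    rw [Units.val_zpow_eq_zpow_val] at h2
    exact h2.symm
  have h2 : algebraMap B L ((u ^ i : Bˣ) : B) = algebraMap B L u ^ i := by
    have := map_zpow (Units.map (algebraMap B L : B →* L)) u i
    have h2 := congrArg Units.val this
    rw [Units.val_zpow_eq_zpow_val] at h2
    exact h2
  have h3 : g • unifL B L ^ i = (g • unifL B L) ^ i :=
    map_zpow₀ (MulSemiringAction.toRingHom G L g) _ _
  rw [h1, h.gradedMap_residue hi, h.gradedMap_residue hi,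
    ← h.map_smul _ _ _ (powSubmodule_anti hi (algebraMap_mul_unifL_zpow_mem _ i)), smul_mul',
    h3, hu, ← algebraMap.smul', mul_zpow, _root_.map_mul, h2, mul_assoc]

/-- If the maps in `X` that vanish on the `i + 1`-st power of the maximal ideal also vanish on the
`i`-th one, except when `i ≡ b` modulo `m`, then `dim X ≤ dim E`. -/
theorem finrank_le [FiniteDimensional (ResidueField A) X] [FiniteDimensional (ResidueField A) E]
    [FiniteDimensional (ResidueField A) (ResidueField B)]
    [IsGalois (ResidueField A) (ResidueField B)]
    (hsurj : ∀ γ : ResidueField B ≃ₐ[ResidueField A] ResidueField B,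
      ∃ g : G, ∀ c : B, residue B (g • c) = γ (residue B c))
    {m t : ℕ} (hm : 0 < m)
    (hstep : ∀ i, b ≤ i → ¬ i ≡ b [ZMOD m] → vanishing B ev (i + 1) ≤ vanishing B ev i)
    (hord : ∃ a ∈ maximalIdeal A, ord B (algebraMap B L (algebraMap A B a)) = (m * t : ℕ) ∧
      algebraMap B L (algebraMap A B a) ≠ 0)
    {σ : G} (hσ : ∀ c : B, residue B (σ • c) = residue B c) {u : Bˣ}
    (hu : σ • unifL B L = algebraMap B L u * unifL B L)
    (hinj : Set.InjOn (fun j : ℕ => residue B u ^ (b + m * j)) (Finset.range t)) :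
    finrank (ResidueField A) X ≤ finrank (ResidueField A) E := by
  have hbj : ∀ j : ℕ, b ≤ b + m * j := fun j => le_add_of_nonneg_right (by positivity)
  -- The filtration is constant strictly between consecutive exponents congruent to `b` modulo `m`.
  have hconst : ∀ (j r : ℕ), r < m →
      vanishing B ev (b + m * j + 1 + r) = vanishing B ev (b + m * j + 1) := by
    intro j r hr
    induction r with
    | zero => simp
    | succ r ih =>
      rw [← ih (by omega)]
      refine le_antisymm ?_ (h.vanishing_mono (by push_cast; omega))
      have h1 := hstep (b + m * j + 1 + r) (by have := hbj j; omega) (by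
        rw [Int.modEq_iff_dvd]
        intro hd
        have h2 : (m : ℤ) ∣ (r + 1 : ℕ) := by
          obtain ⟨c, hc⟩ := hd
          exact ⟨-c - j, by push_cast; linear_combination -hc⟩
        have := Nat.le_of_dvd (by omega) (Int.natCast_dvd_natCast.1 h2)
        omega)
      convert h1 using 2
      push_cast; ring
  have hnext : ∀ j : ℕ, vanishing B ev (b + m * (j + 1 : ℕ)) =
      vanishing B ev (b + m * j + 1) := by
    intro j
    rw [← hconst j (m - 1) (by omega)]
    congr 1
    rw [Nat.cast_sub (by omega)]
    push_cast
    ring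
  have hsum : ∀ j : ℕ, finrank (ResidueField A) (vanishing B ev (b + m * j)) =
      ∑ i ∈ Finset.range j, finrank (ResidueField A) (LinearMap.range (h.gradedMap (hbj i))) := by
    intro j
    induction j with
    | zero =>
      have h1 : vanishing B ev (b + m * (0 : ℕ)) = ⊥ := by
        rw [Nat.cast_zero, mul_zero, add_zero, eq_bot_iff]
        exact fun f hf => h.eq_zero f hf
      rw [h1, finrank_bot, Finset.sum_range_zero]
    | succ j ih =>
      rw [hnext, h.finrank_vanishing_add_one (hbj j), ih, Finset.sum_range_succ]
  -- The `(b + m t)`-th power of the maximal ideal is `a` times the `b`-th one, and `a` acts as zero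
  -- on `E`.
  have htop : vanishing B ev (b + m * t) = ⊤ := by
    obtain ⟨a, ha, ha', ha0⟩ := hord
    refine eq_top_iff.2 fun f _ x hx => ?_
    have h1 : (algebraMap B L (algebraMap A B a))⁻¹ * x ∈ powSubmodule B L b := by
      rw [mul_mem_powSubmodule_iff (inv_ne_zero ha0), ord_inv ha0, ha'] at *
      convert hx using 2
      push_cast; ring
    have h2 := h.map_mul f a _ h1
    rw [mul_inv_cancel_left₀ ha0, (residue_eq_zero_iff a).2 ha, zero_smul] at h2
    exact h2
  have h1 := hsum t
  rw [htop, finrank_top] at h1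
  rw [h1, ← Coextension.finrank_eq (k := ResidueField A) (l := ResidueField B) (E := E)]
  refine sum_finrank_le_of_forall_semilinear (l := ResidueField B) _ ?_ (Coextension.postcomp (ρ σ))
    hinj ?_
  · intro j _ γ
    obtain ⟨g, hg⟩ := hsurj γ
    obtain ⟨w, hw⟩ := exists_unit_mul_zpow_ord (B := B) (x := g • unifL B L)
      (by rw [Ne, smul_eq_zero_iff_eq]; exact unifL_ne_zero B L)
    rw [ord_smul, ord_unifL, zpow_one] at hw
    have hw0 : residue B w ≠ 0 := by simp
    -- Here `g` lifts `γ`. The factor `w ^ (-(b + m j))` compensates for `g Π = w Π`, so that graded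
    -- maps are fixed.
    refine ⟨Coextension.conj (ρ g) (γ.symm.toLinearMap.comp
      (LinearMap.mulRight _ (residue B w ^ (-(b + m * j))))), ?_, ?_⟩
    · intro a ψ
      refine Coextension.ext fun μ => ?_
      simp only [Coextension.conj_apply, Coextension.smul_apply, LinearMap.comp_apply,
        LinearMap.mulRight_apply, AlgEquiv.toLinearMap_apply, _root_.map_mul,
        AlgEquiv.symm_apply_apply, mul_assoc]
    · rintro _ ⟨f, rfl⟩
      refine Coextension.ext fun μ => ?_
      rw [Coextension.conj_apply, LinearMap.comp_apply, AlgEquiv.toLinearMap_apply,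
        LinearMap.mulRight_apply]
      obtain ⟨c, hc⟩ := residue_surjective (γ.symm (μ * residue B w ^ (-(b + m * j))))
      rw [← hc, h.map_gradedMap _ _ g hw, hg, hc, AlgEquiv.apply_symm_apply, mul_assoc,
        ← zpow_add₀ hw0, neg_add_cancel, zpow_zero, mul_one]
  · rintro j _ _ ⟨f, rfl⟩
    refine Coextension.ext fun μ => ?_
    obtain ⟨c, rfl⟩ := residue_surjective μ
    rw [Coextension.smul_apply, mul_comm (residue B u ^ (b + m * j : ℤ))]
    refine (h.map_gradedMap _ _ σ hu c).trans ?_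
    rw [hσ]

/-- Write `x = ∑ τ (w τ)` with `∑ w τ` one step deeper in the filtration. Since `H` acts trivially
on `E`, `f` takes the same value on `x` and on `∑ w τ`. -/
theorem vanishing_le_of_weaklyRamified {H : Type*} [Group H] [Fintype H] [MulSemiringAction H B]
    [MulSemiringAction H L] [SMulDistribClass H B L] [FaithfulSMul H L] (φ : H → G)
    (hφ : ∀ (τ : H) (x : L), τ • x = φ τ • x) (htriv : ∀ τ, ρ (φ τ) = 1)
    (ht : IsTotallyRamified B L H) {p : ℕ} [Fact p.Prime] (hH : IsPGroup p H)
    (hp : (p : B) ∈ maximalIdeal B)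
    (hδ : ord B (differentElement B L H) = (Fintype.card H - 1) * 2)
    (hb : b ≡ 1 [ZMOD Fintype.card H]) {i : ℤ} (hbi : b ≤ i)
    (hi : ¬ i ≡ b [ZMOD Fintype.card H]) : vanishing B ev (i + 1) ≤ vanishing B ev i := by
  intro f hf x hx
  obtain ⟨w, hw, rfl, hs⟩ := ht.exists_eq_sum_smul_of_weaklyRamified hH hp hδ hb hbi hi hx
  have key : ∀ (s : Finset H) (v : H → L), (∀ τ, v τ ∈ powSubmodule B L b) →
      ev f (∑ τ ∈ s, v τ) = ∑ τ ∈ s, ev f (v τ) := by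
    intro s v hv
    classical
    induction s using Finset.induction_on with
    | empty =>
      have := h.map_add f 0 (zero_mem _) 0 (zero_mem _)
      rw [add_zero, left_eq_add] at this
      simpa using this
    | insert a s ha ih =>
      rw [Finset.sum_insert ha, Finset.sum_insert ha, h.map_add f _ (hv a) _
        (Submodule.sum_mem _ fun τ _ => hv τ), ih]
  rw [key _ _ fun τ => smul_mem_powSubmodule τ (hw τ)]
  rw [← hf _ hs, key _ _ hw]
  refine Finset.sum_congr rfl fun τ _ => ?_
  rw [hφ, h.map_smul _ _ _ (hw τ), htriv]
  rfl

end IsEquivariantEval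

end HomBound

end DVRExtension

/-! ### Residue extension and the tame character -/

namespace DVRExtension

section ResidueField

open IsLocalRing

variable (A : Type*) {B : Type*} (G : Type*) [CommRing A] [IsLocalRing A] [CommRing B]
  [IsLocalRing B] [Algebra A B] [IsLocalHom (algebraMap A B)] [Group G] [Finite G]
  [MulSemiringAction G B] [IsGaloisGroup G A B]

theorem exists_forall_residue_smul_eq (γ : ResidueField B ≃ₐ[ResidueField A] ResidueField B) :
    ∃ g : G, ∀ c : B, residue B (g • c) = γ (residue B c) := by
  have := IsGaloisGroup.isInvariant (G := G) (A := A) (B := B)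
  have := IsGaloisGroup.commutes (G := G) (A := A) (B := B)
  obtain ⟨g, hg⟩ := Ideal.Quotient.stabilizerHom_surjective G (maximalIdeal A) (maximalIdeal B) γ
  exact ⟨g, fun c => DFunLike.congr_fun hg (Ideal.Quotient.mk _ c)⟩

theorem isGalois_residueField (A B G : Type*) [CommRing A] [IsLocalRing A] [CommRing B]
    [IsLocalRing B] [Algebra A B] [IsLocalHom (algebraMap A B)] [Group G] [Finite G]
    [MulSemiringAction G B] [IsGaloisGroup G A B] [PerfectField (ResidueField A)]
    [Module.Finite A B] :
    IsGalois (ResidueField A) (ResidueField B) := by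
  have := IsGaloisGroup.isInvariant (G := G) (A := A) (B := B)
  have h1 : Normal (ResidueField A) (ResidueField B) :=
    Ideal.Quotient.normal G (maximalIdeal A) (maximalIdeal B)
  have h2 : Algebra.IsAlgebraic (ResidueField A) (ResidueField B) := inferInstance
  have h3 : Algebra.IsSeparable (ResidueField A) (ResidueField B) := inferInstance
  exact { }

end ResidueField

section TameCharacter

open IsLocalRing

variable {B L G : Type*} [CommRing B] [IsDomain B]
  [IsDiscreteValuationRing B] [Field L] [Algebra B L] [IsFractionRing B L]
  [Group G] [MulSemiringAction G B] [MulSemiringAction G L] [SMulDistribClass G B L]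

theorem exists_unit_smul_unifL (g : G) :
    ∃ u : Bˣ, g • unifL B L = algebraMap B L u * unifL B L := by
  obtain ⟨w, hw⟩ := exists_unit_mul_zpow_ord (B := B) (x := g • unifL B L)
    (by rw [Ne, smul_eq_zero_iff_eq]; exact unifL_ne_zero B L)
  rw [ord_smul, ord_unifL, zpow_one] at hw
  exact ⟨w, hw⟩

theorem residue_smul_of_mem_inertia {g : G} (hg : g ∈ (maximalIdeal B).inertia G) (c : B) :
    residue B (g • c) = residue B c := by
  rw [← sub_eq_zero, ← map_sub, residue_eq_zero_iff]
  exact hg c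

variable (B L) in
/-- The unit `g Π / Π` of `B`, where `Π` is the chosen uniformizer. -/
noncomputable def unifCocycle (g : G) : Bˣ := (exists_unit_smul_unifL (B := B) (L := L) g).choose

theorem smul_unifL (g : G) :
    g • unifL B L = algebraMap B L (unifCocycle B L g) * unifL B L :=
  (exists_unit_smul_unifL g).choose_spec

theorem unifCocycle_eq {g : G} {u : Bˣ} (hu : g • unifL B L = algebraMap B L u * unifL B L) :
    (unifCocycle B L g : B) = u := by
  rw [smul_unifL, mul_left_inj' (unifL_ne_zero B L)] at hu
  exact IsFractionRing.injective B L hu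

variable (B L G) in
/-- The tame character of the inertia group `I`: it maps `σ` to the residue class of `σ Π / Π`,
where `Π` is a uniformizer. -/
noncomputable def tameCharacter : (maximalIdeal B).inertia G →* ResidueField B where
  toFun σ := residue B (unifCocycle B L (σ : G) : B)
  map_one' := by
    rw [unifCocycle_eq (u := 1) (by simp), Units.val_one, map_one]
  -- The unit attached to `σ τ` is `σ(u_τ) u_σ`, and inertia does not change residues.
  map_mul' σ τ := by
    rw [← residue_smul_of_mem_inertia σ.2 (unifCocycle B L (τ : G) : B), ← map_mul, mul_comm]
    congr 1
    refine unifCocycle_eq (L := L) (g := ((σ * τ : (maximalIdeal B).inertia G) : G))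
      (u := Units.map (MulSemiringAction.toRingHom G B (σ : G)) (unifCocycle B L (τ : G)) *
        unifCocycle B L (σ : G)) ?_
    rw [Subgroup.coe_mul, mul_smul, smul_unifL (τ : G), smul_mul', smul_unifL (σ : G),
      ← algebraMap.smul', ← mul_assoc, ← map_mul]
    rfl

theorem tameCharacter_apply (σ : (maximalIdeal B).inertia G) :
    tameCharacter B L G σ = residue B (unifCocycle B L (σ : G) : B) := rfl

theorem tameCharacter_eq_one_iff (σ : (maximalIdeal B).inertia G) :
    tameCharacter B L G σ = 1 ↔ σ • unifL B L - unifL B L ∈ powSubmodule B L 2 := by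
  rw [tameCharacter_apply]
  have hu := smul_unifL (B := B) (L := L) (σ : G)
  generalize unifCocycle B L (σ : G) = u at *
  have h1 : σ • unifL B L = algebraMap B L u * unifL B L := hu
  have h2 : algebraMap B L u * unifL B L - unifL B L = unifL B L * algebraMap B L (u - 1) := by
    rw [map_sub, map_one]; ring
  rw [h1, h2, mul_mem_powSubmodule_iff (unifL_ne_zero B L), ord_unifL,
    show (2 - 1 : ℤ) = 1 by norm_num, algebraMap_mem_powSubmodule_one, ← residue_eq_zero_iff,
    map_sub, map_one, sub_eq_zero]

theorem inertia_mono {I J : Ideal B} (h : I ≤ J) : I.inertia G ≤ J.inertia G :=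
  fun _ hg x => h (hg x)

theorem tameCharacter_eq_one_iff_mem [Finite G] [FaithfulSMul G L]
    (ht : ∀ x : L, (∀ σ ∈ (maximalIdeal B).inertia G, σ • x = x) →
      (Nat.card ((maximalIdeal B).inertia G) : ℤ) ∣ ord B x)
    (σ : (maximalIdeal B).inertia G) :
    tameCharacter B L G σ = 1 ↔ (σ : G) ∈ (maximalIdeal B ^ 2).inertia G := by
  have := Fintype.ofFinite ((maximalIdeal B).inertia G)
  have ht' : IsTotallyRamified B L ((maximalIdeal B).inertia G) := fun x hx => by
    rw [← Nat.card_eq_fintype_card]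
    exact ht x fun σ hσ => hx ⟨σ, hσ⟩
  rw [tameCharacter_eq_one_iff]
  exact (ht'.forall_smul_sub_mem_iff σ 2).symm

/-- There is an element of the inertia group whose image under the tame character has order
prime to `p` and equal to the index of the wild inertia group. -/
theorem exists_mem_inertia_injOn [Finite G] [FaithfulSMul G L]
    (ht : ∀ x : L, (∀ σ ∈ (maximalIdeal B).inertia G, σ • x = x) →
      (Nat.card ((maximalIdeal B).inertia G) : ℤ) ∣ ord B x)
    {p : ℕ} [Fact p.Prime] [CharP (ResidueField B) p]
    (hp : IsPGroup p ((maximalIdeal B ^ 2).inertia G)) :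
    ∃ σ ∈ (maximalIdeal B).inertia G, ∃ (u : Bˣ) (t : ℕ),
      σ • unifL B L = algebraMap B L u * unifL B L ∧
      Nat.card ((maximalIdeal B ^ 2).inertia G) * t = Nat.card ((maximalIdeal B).inertia G) ∧
      ∀ b : ℤ, Set.InjOn (fun j : ℕ =>
        residue B u ^ (b + Nat.card ((maximalIdeal B ^ 2).inertia G) * j)) (Finset.range t) := by
  let χ := (tameCharacter B L G).toHomUnits
  have hker : χ.ker = ((maximalIdeal B ^ 2).inertia G).subgroupOf ((maximalIdeal B).inertia G) := by
    ext σ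
    rw [MonoidHom.mem_ker, Subgroup.mem_subgroupOf, ← tameCharacter_eq_one_iff_mem ht,
      ← Units.val_inj]
    rfl
  have hle : (maximalIdeal B ^ 2).inertia G ≤ (maximalIdeal B).inertia G :=
    inertia_mono (Ideal.pow_le_self two_ne_zero)
  have hcard : Nat.card ((maximalIdeal B ^ 2).inertia G) * Nat.card χ.range =
      Nat.card ((maximalIdeal B).inertia G) := by
    rw [← Nat.card_congr (Subgroup.subgroupOfEquivOfLe hle).toEquiv, ← hker,
      ← Subgroup.index_ker, Subgroup.card_mul_index]
  have : Finite χ.range := Finite.of_surjective _ χ.rangeRestrict_surjective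
  obtain ⟨⟨ζ, hζr⟩, hζ⟩ := IsCyclic.exists_ofOrder_eq_natCard (α := χ.range)
  rw [Subgroup.orderOf_mk] at hζ
  obtain ⟨σ, hσ⟩ := hζr
  have hζu : (ζ : ResidueField B) = residue B (unifCocycle B L (σ : G)) := by
    rw [← tameCharacter_apply, ← hσ]; rfl
  -- Frobenius is injective on a field of characteristic `p`, so there are no nontrivial `p`-th
  -- roots of unity.
  have hcop : ¬ p ∣ orderOf ζ := by
    rintro ⟨s, hs⟩
    have h1 : (ζ ^ s) ^ p = 1 := by rw [← pow_mul, mul_comm, ← hs, pow_orderOf_eq_one]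
    have h2 : ((ζ ^ s : (ResidueField B)ˣ) : ResidueField B) = 1 := by
      apply frobenius_inj (ResidueField B) p
      rw [frobenius_def, frobenius_def, one_pow, ← Units.val_pow_eq_pow_val, h1, Units.val_one]
    have h3 := orderOf_dvd_of_pow_eq_one (Units.val_eq_one.1 h2)
    have hs0 : 0 < s := Nat.pos_of_ne_zero (by
      rintro rfl
      have := Nat.card_pos (α := χ.range)
      omega)
    have h4 := Nat.le_of_dvd hs0 h3
    have := (Fact.out : p.Prime).two_le
    nlinarith
  refine ⟨σ, σ.2, unifCocycle B L (σ : G), Nat.card χ.range, smul_unifL _, hcard, ?_⟩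
  intro b i hi j hj hij
  rw [Finset.coe_range, Set.mem_Iio] at hi hj
  have h1 : ζ ^ (b + Nat.card ((maximalIdeal B ^ 2).inertia G) * i : ℤ) =
      ζ ^ (b + Nat.card ((maximalIdeal B ^ 2).inertia G) * j : ℤ) := by
    rw [← Units.val_inj, Units.val_zpow_eq_zpow_val, Units.val_zpow_eq_zpow_val, hζu]
    exact hij
  rw [zpow_eq_zpow_iff_modEq] at h1
  have h2 := Int.ModEq.add_left_cancel' b h1
  obtain ⟨r, hr⟩ := IsPGroup.iff_card.1 hp
  -- Wild inertia has order a power of `p`, so multiplication by it is injective modulo the order of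
  -- `ζ`.
  have hco : Nat.Coprime (orderOf ζ) (Nat.card ((maximalIdeal B ^ 2).inertia G)) := by
    rw [hr]
    exact (Nat.Coprime.pow_left r (((Fact.out : p.Prime).coprime_iff_not_dvd).2 hcop)).symm
  rw [← Nat.cast_mul, ← Nat.cast_mul, Int.natCast_modEq_iff] at h2
  have h3 := Nat.ModEq.cancel_left_of_coprime hco h2
  rw [hζ] at h3
  exact Nat.ModEq.eq_of_lt_of_lt h3 hi hj

end TameCharacter

end DVRExtension

/-! ### Modules over group rings -/

namespace DVRExtension

section GroupRing

open IsLocalRing Module MonoidAlgebra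

universe u

/-- The coefficients of `c` are constant on the cosets `H g`. Keep only those at chosen coset
representatives; translating by `H` recovers `c`. -/
theorem exists_sum_single_mul_eq {A G : Type*} [CommRing A] [Group G] (H : Subgroup G) [Fintype H]
    {c : A[G]} (hc : ∀ h ∈ H, single h (1 : A) * c = c) :
    ∃ d : A[G], ∑ h : H, single (h : G) (1 : A) * d = c := by
  classical
  let r : G → G := fun g => (Quotient.mk (QuotientGroup.rightRel H) g).out
  have hr : ∀ g, g * (r g)⁻¹ ∈ H := fun g =>
    QuotientGroup.rightRel_apply.1 (Quotient.mk_out (s := QuotientGroup.rightRel H) g)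
  have hr' : ∀ h ∈ H, ∀ g, r (h * g) = r g := by
    intro h hh g
    refine congrArg Quotient.out (Quotient.sound (QuotientGroup.rightRel_apply.2 ?_))
    rw [mul_inv_rev, mul_inv_cancel_left]
    exact H.inv_mem hh
  refine ⟨ofCoeff (c.coeff.filter fun g => r g = g), ?_⟩
  ext g
  rw [coeff_sum, Finsupp.finsetSum_apply]
  simp_rw [coeff_single_mul_apply, one_mul, Finsupp.filter_apply]
  rw [Finset.sum_eq_single (⟨g * (r g)⁻¹, hr g⟩ : H)]
  · have h1 : (g * (r g)⁻¹)⁻¹ * g = r g := by group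
    have h2 : r (r g) = r g := by
      conv_rhs => rw [← hr' _ (H.inv_mem (hr g)) g, h1]
    rw [if_pos (by rw [h1, h2])]
    have h3 := congrArg (fun d : A[G] => d.coeff g) (hc _ (hr g))
    simpa [coeff_single_mul_apply] using h3
  · intro h _ hne
    rw [if_neg]
    intro h1
    rw [hr' _ (H.inv_mem h.2)] at h1
    refine hne (Subtype.ext (eq_mul_inv_of_mul_eq ?_))
    rw [h1, mul_inv_cancel_left]
  · intro h
    exact absurd (Finset.mem_univ _) h

/-- In a free module over a group ring, the elements fixed by a finite subgroup are traces. -/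
theorem exists_sum_single_smul_eq_of_free {A G M : Type*} [CommRing A] [Group G] (H : Subgroup G)
    [Fintype H] [AddCommGroup M] [Module A[G] M] [Module.Free A[G] M] {x : M}
    (hx : ∀ h ∈ H, single h (1 : A) • x = x) :
    ∃ y : M, ∑ h : H, single (h : G) (1 : A) • y = x := by
  let v := Module.Free.chooseBasis A[G] M
  have h1 : ∀ i, ∃ d : A[G], ∑ h : H, single (h : G) (1 : A) * d = v.repr x i := by
    intro i
    refine exists_sum_single_mul_eq H fun h hh => ?_
    conv_rhs => rw [← hx h hh]
    rw [map_smul, Finsupp.smul_apply, smul_eq_mul]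
  choose d hd using h1
  refine ⟨∑ i ∈ (v.repr x).support, d i • v i, ?_⟩
  simp_rw [Finset.smul_sum]
  rw [Finset.sum_comm]
  simp_rw [← smul_assoc, smul_eq_mul, ← Finset.sum_smul, hd]
  exact v.linearCombination_repr x

/-- A normal `p`-subgroup acts trivially on a simple module in characteristic `p`. -/
theorem single_smul_eq_of_isPGroup {k G E : Type*} [Field k] [Group G] {p : ℕ} [Fact p.Prime]
    [CharP k p] (N : Subgroup G) [N.Normal] [Finite N] (hN : IsPGroup p N) [AddCommGroup E]
    [Module k E] [Module k[G] E] [IsScalarTower k k[G] E] [IsSimpleModule k[G] E] {τ : G}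
    (hτ : τ ∈ N) (e : E) : single τ (1 : k) • e = e := by
  -- The vectors fixed by `N` form a `k[G]`-submodule because `N` is normal. It is nonzero because
  -- `N` is a `p`-group, hence it is everything by simplicity.
  let F : Submodule k[G] E :=
    { carrier := {e | ∀ τ ∈ N, single τ (1 : k) • e = e}
      add_mem' := fun ha hb τ hτ => by rw [smul_add, ha τ hτ, hb τ hτ]
      zero_mem' := fun τ _ => smul_zero _
      smul_mem' := by
        intro c e he τ hτ
        induction c using MonoidAlgebra.induction_linear with
        | zero => rw [zero_smul, smul_zero]
        | add c d hc hd => rw [add_smul, smul_add, hc, hd]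
        | single g a =>
          have h1 : g⁻¹ * τ * g ∈ N := by
            simpa using (inferInstance : N.Normal).conj_mem τ hτ g⁻¹
          conv_rhs => rw [← he _ h1]
          rw [smul_smul, smul_smul, single_mul_single, single_mul_single, one_mul, mul_one,
            ← mul_assoc, ← mul_assoc, mul_inv_cancel, one_mul] }
  have hnt := IsSimpleModule.nontrivial k[G] E
  obtain ⟨x, hx⟩ := exists_ne (0 : E)
  let r : N →* AddMonoid.End E :=
    { toFun := fun τ => DistribSMul.toAddMonoidHom E (single (τ : G) (1 : k))
      map_one' := AddMonoidHom.ext fun e => by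
        change (1 : k[G]) • e = e
        rw [one_smul]
      map_mul' := fun σ τ => AddMonoidHom.ext fun e => by
        change single ((σ : G) * τ) (1 : k) • e =
          single (σ : G) (1 : k) • single (τ : G) (1 : k) • e
        rw [smul_smul, single_mul_single, one_mul] }
  obtain ⟨y, -, hy0, hy⟩ := exists_fixed_ne_zero_of_isPGroup hN r
    (fun x => by rw [← Nat.cast_smul_eq_nsmul k, CharP.cast_eq_zero, zero_smul]) ⊤
    (fun _ _ _ => trivial) (AddSubgroup.mem_top x) hx
  have hF : F = ⊤ := (eq_bot_or_eq_top F).resolve_left fun h => hy0 (by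
    have : y ∈ F := fun τ hτ => hy ⟨τ, hτ⟩
    rwa [h, Submodule.mem_bot] at this)
  have he : e ∈ F := hF ▸ Submodule.mem_top
  exact he τ hτ

/-- By Nakayama `x` generates `M`. The resulting surjection `A[G] → M` joins free `A`-modules of the
same finite rank, so it is injective. -/
theorem free_of_span_sup_eq_top {A G M : Type*} [CommRing A] [IsLocalRing A] [Group G] [Finite G]
    [AddCommGroup M] [Module A M] [Module A[G] M] [IsScalarTower A A[G] M] [Module.Free A M]
    [Module.Finite A M] (hrank : finrank A M = Nat.card G) {x : M}
    (hx : (Submodule.span A[G] {x}).restrictScalars A ⊔ maximalIdeal A • (⊤ : Submodule A M) = ⊤) :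
    Module.Free A[G] M := by
  have hsp : (Submodule.span A[G] {x}).restrictScalars A = ⊤ := by
    refine top_le_iff.1 (Submodule.le_of_le_smul_of_le_jacobson_bot Module.Finite.fg_top
      (jacobson_eq_maximalIdeal ⊥ bot_ne_top).ge ?_)
    exact hx.ge
  have hfree : Module.Free A A[G] := Module.Free.of_equiv (coeffLinearEquiv A).symm
  have hfin : Module.Finite A A[G] := Module.Finite.equiv (coeffLinearEquiv A).symm
  have hr : finrank A A[G] = Nat.card G := by
    have := Fintype.ofFinite G
    rw [(coeffLinearEquiv A).finrank_eq, finrank_finsupp_self, Nat.card_eq_fintype_card]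
  let f := LinearMap.toSpanSingleton A[G] M x
  have hfs : Function.Surjective f := by
    rw [← LinearMap.range_eq_top, LinearMap.range_toSpanSingleton]
    exact (Submodule.restrictScalars_eq_top_iff A A[G] M).1 hsp
  let e : M ≃ₗ[A] A[G] := LinearEquiv.ofFinrankEq M A[G] (hrank.trans hr.symm)
  have hfi : Function.Injective f := by
    have h1 : Function.Surjective (e.toLinearMap.comp (f.restrictScalars A)) :=
      e.surjective.comp hfs
    have h2 := OrzechProperty.injective_of_surjective_endomorphism _ h1
    exact Function.Injective.of_comp h2
  exact Module.Free.of_equiv (LinearEquiv.ofBijective f ⟨hfi, hfs⟩)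

/-- Group ring coefficients lift from the residue field to `A`, so a generator of the reduction
lifts to a generator modulo the maximal ideal. -/
theorem span_sup_eq_top_of_map {A G M V : Type*} [CommRing A] [IsLocalRing A] [Group G]
    [AddCommGroup M] [Module A M] [Module A[G] M] [IsScalarTower A A[G] M]
    [AddCommGroup V] [Module (ResidueField A) V] [Module (ResidueField A)[G] V]
    [IsScalarTower (ResidueField A) (ResidueField A)[G] V]
    (q : M →+ V) (hq : ∀ (a : A) m, q (a • m) = residue A a • q m)
    (hqG : ∀ (g : G) m, q (single g (1 : A) • m) = single g (1 : ResidueField A) • q m)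
    (hker : ∀ m, q m = 0 → m ∈ maximalIdeal A • (⊤ : Submodule A M)) {x : M}
    (hx : Submodule.span (ResidueField A)[G] {q x} = ⊤) :
    (Submodule.span A[G] {x}).restrictScalars A ⊔ maximalIdeal A • (⊤ : Submodule A M) = ⊤ := by
  have h1 : ∀ c : (ResidueField A)[G], ∃ d : A[G], q (d • x) = c • q x := by
    intro c
    induction c using MonoidAlgebra.induction_linear with
    | zero => exact ⟨0, by rw [zero_smul, zero_smul, map_zero]⟩
    | add c c' hc hc' =>
      obtain ⟨d, hd⟩ := hc
      obtain ⟨d', hd'⟩ := hc'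
      exact ⟨d + d', by rw [add_smul, add_smul, map_add, hd, hd']⟩
    | single g a =>
      obtain ⟨a, rfl⟩ := residue_surjective a
      refine ⟨a • single g 1, ?_⟩
      rw [smul_assoc, hq, hqG, ← smul_assoc, smul_single', mul_one]
  refine top_le_iff.1 fun m _ => ?_
  have hm : q m ∈ Submodule.span (ResidueField A)[G] {q x} := hx ▸ Submodule.mem_top
  obtain ⟨c, hc⟩ := Submodule.mem_span_singleton.1 hm
  obtain ⟨d, hd⟩ := h1 c
  refine Submodule.mem_sup.2 ⟨d • x, ?_, m - d • x, hker _ ?_, by abel⟩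
  · exact Submodule.smul_mem _ _ (Submodule.mem_span_singleton_self x)
  · rw [map_sub, hd, hc, sub_self]

/-- The residue module of `M` is a vector space over the residue field. -/
noncomputable abbrev residueModule (A M : Type*) [CommRing A] [IsLocalRing A]
    [AddCommGroup M] [Module A M] :
    Module (ResidueField A) (M ⧸ maximalIdeal A • (⊤ : Submodule A M)) :=
  inferInstanceAs (Module (A ⧸ maximalIdeal A) (M ⧸ maximalIdeal A • (⊤ : Submodule A M)))

/-- The reduction of a representation over a local ring modulo the maximal ideal. -/
theorem exists_reduction {A G : Type*} {M : Type u} [CommRing A] [IsLocalRing A] [Group G]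
    [AddCommGroup M] [Module A M] [Module.Finite A M] (ρ : Representation A G M) :
    ∃ (V : Type u) (_ : AddCommGroup V) (_ : Module (ResidueField A) V)
      (_ : Module (ResidueField A)[G] V) (_ : IsScalarTower (ResidueField A) (ResidueField A)[G] V)
      (_ : Module.Finite (ResidueField A) V) (q : M →+ V), Function.Surjective q ∧
      (∀ (a : A) m, q (a • m) = residue A a • q m) ∧
      (∀ (g : G) m, q (ρ g m) = single g (1 : ResidueField A) • q m) ∧
      ∀ m, q m = 0 ↔ m ∈ maximalIdeal A • (⊤ : Submodule A M) := by
  obtain ⟨N, hNe, instN, hsmul⟩ : ∃ N, N = maximalIdeal A • (⊤ : Submodule A M) ∧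
      ∃ _ : Module (ResidueField A) (M ⧸ N), ∀ (a : A) (m : M ⧸ N), residue A a • m = a • m :=
    ⟨_, rfl, residueModule A M, fun _ _ => rfl⟩
  rw [← hNe]
  have hN : ∀ g, N ≤ N.comap (ρ g) := by
    intro g
    rw [hNe, ← Submodule.map_le_iff_le_comap, Submodule.map_smul'']
    exact smul_mono_right _ le_top
  let ρ' : Representation (ResidueField A) G (M ⧸ N) :=
    { toFun := fun g =>
        { toFun := N.mapQ N (ρ g) (hN g)
          map_add' := map_add _
          map_smul' := fun c m => by
            obtain ⟨a, rfl⟩ := residue_surjective c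
            rw [hsmul, map_smul, RingHom.id_apply, hsmul] }
      map_one' := LinearMap.ext fun m => by
        obtain ⟨m, rfl⟩ := N.mkQ_surjective m
        change N.mkQ (ρ 1 m) = N.mkQ m
        rw [map_one]; rfl
      map_mul' := fun g g' => LinearMap.ext fun m => by
        obtain ⟨m, rfl⟩ := N.mkQ_surjective m
        change N.mkQ (ρ (g * g') m) = N.mkQ (ρ g (ρ g' m))
        rw [map_mul]; rfl }
  have hfin : Module.Finite (ResidueField A) (M ⧸ N) := by
    obtain ⟨s, hs⟩ := (inferInstance : Module.Finite A (M ⧸ N)).fg_top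
    refine ⟨s, eq_top_iff.2 fun m _ => ?_⟩
    have hm : m ∈ Submodule.span A (s : Set (M ⧸ N)) := hs ▸ Submodule.mem_top
    induction hm using Submodule.span_induction with
    | mem m hm => exact Submodule.subset_span hm
    | zero => exact zero_mem _
    | add a b _ _ ha hb => exact add_mem (ha trivial) (hb trivial)
    | smul a m _ hm => exact hsmul a m ▸ Submodule.smul_mem _ (residue A a) (hm trivial)
  refine ⟨ρ'.asModule, inferInstance, inferInstance, inferInstance, inferInstance, inferInstance,
    (ρ'.asModuleEquiv.symm.toAddMonoidHom).comp N.mkQ.toAddMonoidHom, ?_, ?_, ?_, ?_⟩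
  · exact ρ'.asModuleEquiv.symm.surjective.comp N.mkQ_surjective
  · exact fun a m => congrArg ρ'.asModuleEquiv.symm (hsmul a (N.mkQ m)).symm
  · intro g m
    exact ρ'.asModuleEquiv_symm_map_rho g (N.mkQ m)
  · intro m
    exact Submodule.Quotient.mk_eq_zero N

end GroupRing

end DVRExtension

/-! ### The two implications for powers of the maximal ideal -/

namespace DVRExtension

section FreeLattice

open IsLocalRing Module MonoidAlgebra

universe u

variable {A B L G : Type*} {M : Type u} [CommRing A] [IsDomain A] [IsDiscreteValuationRing A]
  [CommRing B] [IsDomain B] [IsDiscreteValuationRing B] [Algebra A B] [Module.Finite A B]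
  [FaithfulSMul A B] [Field L] [Algebra B L] [IsFractionRing B L] [Group G]
  [MulSemiringAction G B] [IsGaloisGroup G A B] [MulSemiringAction G L] [SMulDistribClass G B L]
  [AddCommGroup M] [Module A M]

/-- The map `ι` identifies the representation `ρ` with the `b`-th power of the maximal ideal
of `B`. -/
structure IsPowModel (B : Type*) {A L G M : Type*} [CommRing A] [CommRing B] [IsDomain B]
    [IsDiscreteValuationRing B] [Algebra A B] [Field L] [Algebra B L] [IsFractionRing B L] [Group G]
    [MulSemiringAction G L] [AddCommGroup M] [Module A M] (b : ℤ) (ρ : Representation A G M)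
    (ι : M →+ L) : Prop where
  injective : Function.Injective ι
  mem_iff : ∀ x, x ∈ powSubmodule B L b ↔ ∃ m, ι m = x
  map_smul : ∀ (a : A) m, ι (a • m) = algebraMap B L (algebraMap A B a) * ι m
  map_rho : ∀ (g : G) m, ι (ρ g m) = g • ι m

theorem faithfulSMul_of_isGaloisGroup (A B L G : Type*) [CommRing A] [CommRing B] [Algebra A B]
    [Field L] [Algebra B L] [FaithfulSMul B L] [Group G]
    [MulSemiringAction G B] [IsGaloisGroup G A B] [MulSemiringAction G L]
    [SMulDistribClass G B L] : FaithfulSMul G L := by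
  have := IsGaloisGroup.faithful (G := G) (B := B) A
  refine ⟨fun {g g'} h => FaithfulSMul.eq_of_smul_eq_smul (α := B) fun c => ?_⟩
  apply FaithfulSMul.algebraMap_injective B L
  rw [algebraMap.smul', algebraMap.smul', h]

variable (A B L) in
theorem isTotallyRamified_of_le_inertia [PerfectField (ResidueField A)] [Finite G] (H : Subgroup G)
    [Fintype H] (hH : H ≤ (maximalIdeal B).inertia G) : IsTotallyRamified B L H := fun x hx => by
  rw [← Nat.card_eq_fintype_card]
  exact card_dvd_ord A H hH fun σ hσ => hx ⟨σ, hσ⟩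

theorem inertia_pow_le {n : ℕ} (hn : n ≠ 0) :
    (maximalIdeal B ^ n).inertia G ≤ (maximalIdeal B).inertia G :=
  inertia_mono (Ideal.pow_le_self hn)

theorem unifL_sub_smul_ne_zero {H : Type*} [Group H] [Fintype H] [MulSemiringAction H B]
    [MulSemiringAction H L] [SMulDistribClass H B L] [FaithfulSMul H L]
    (ht : IsTotallyRamified B L H) {σ : H} (hσ : σ ≠ 1) : unifL B L - σ • unifL B L ≠ 0 := by
  intro h
  refine hσ (ht.smul_unifL_injective ?_)
  change σ • unifL B L = (1 : H) • unifL B L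
  rw [one_smul, ← sub_eq_zero.1 h]

theorem le_ord_unifL_sub_smul_iff {H : Type*} [Group H] [Fintype H] [MulSemiringAction H B]
    [MulSemiringAction H L] [SMulDistribClass H B L] [FaithfulSMul H L]
    (ht : IsTotallyRamified B L H) {σ : H} (hσ : σ ≠ 1) (s : ℕ) :
    (s : ℤ) ≤ ord B (unifL B L - σ • unifL B L) ↔ ∀ x : B, σ • x - x ∈ maximalIdeal B ^ s := by
  rw [ht.forall_smul_sub_mem_iff, ← mem_powSubmodule_iff_ord (unifL_sub_smul_ne_zero ht hσ),
    ← neg_mem_iff, neg_sub]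

namespace IsPowModel

variable {b : ℤ} {ρ : Representation A G M} {ι : M →+ L} (h : IsPowModel B b ρ ι)
include h

theorem apply_mem (m : M) : ι m ∈ powSubmodule B L b := (h.mem_iff _).2 ⟨m, rfl⟩

/-- Multiplication by `Π ^ b` is an isomorphism. It ignores the action of `G` and serves only to
transfer freeness and rank over `A`. -/
theorem nonempty_linearEquiv : Nonempty (B ≃ₗ[A] M) := by
  have h1 : ∀ c : B, ∃ m, ι m = algebraMap B L c * unifL B L ^ b := fun c =>
    (h.mem_iff _).1 (algebraMap_mul_unifL_zpow_mem c b)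
  choose f hf using h1
  let F : B →ₗ[A] M :=
    { toFun := f
      map_add' := fun x y => h.injective (by rw [map_add, hf, hf, hf, map_add, add_mul])
      map_smul' := fun a x => h.injective (by
        rw [RingHom.id_apply, h.map_smul, hf, hf, Algebra.smul_def, map_mul, mul_assoc]) }
  refine ⟨LinearEquiv.ofBijective F ⟨fun x y hxy => ?_, fun m => ?_⟩⟩
  · have h2 := congrArg ι (show f x = f y from hxy)
    rw [hf, hf, mul_left_inj' (zpow_ne_zero _ (unifL_ne_zero B L))] at h2
    exact IsFractionRing.injective B L h2
  · obtain ⟨c, hc⟩ := mem_powSubmodule.1 (h.apply_mem m)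
    exact ⟨c, h.injective ((hf c).trans hc.symm)⟩

theorem exists_trace_eq_of_free (H : Subgroup G) [Fintype H] [Module.Free A[G] ρ.asModule] {x : L}
    (hx : x ∈ powSubmodule B L b) (hfix : ∀ σ : H, σ • x = x) :
    ∃ y ∈ powSubmodule B L b, trace H y = x := by
  obtain ⟨m, rfl⟩ := (h.mem_iff x).1 hx
  obtain ⟨y, hy⟩ := exists_sum_single_smul_eq_of_free (A := A) H (M := ρ.asModule)
    (x := ρ.asModuleEquiv.symm m) (fun σ hσ => by
      rw [Representation.single_smul, one_smul]
      exact h.injective ((h.map_rho σ m).trans (hfix ⟨σ, hσ⟩)))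
  refine ⟨ι (ρ.asModuleEquiv y), h.apply_mem _, ?_⟩
  have h1 := congrArg (fun z => ι (ρ.asModuleEquiv z)) hy
  simp only [map_sum, LinearEquiv.apply_symm_apply] at h1
  rw [← h1, trace]
  refine Finset.sum_congr rfl fun σ _ => ?_
  rw [Representation.single_smul, one_smul]
  exact (h.map_rho σ _).symm

/-- Freeness makes every fixed element a trace for the wild inertia group, so the trace criterion
applies. A nontrivial element of the third inertia group would have `v(Π - σΠ) ≥ 3`. -/
theorem weaklyRamified_of_free [PerfectField (ResidueField A)] [Finite G]
    [Module.Free A[G] ρ.asModule] :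
    (maximalIdeal B ^ 3).inertia G = ⊥ ∧
      b ≡ 1 [ZMOD (Nat.card ((maximalIdeal B ^ 2).inertia G) : ℤ)] := by
  have := faithfulSMul_of_isGaloisGroup A B L G
  have := Fintype.ofFinite ((maximalIdeal B ^ 2).inertia G)
  have ht := isTotallyRamified_of_le_inertia A B L ((maximalIdeal B ^ 2).inertia G)
    (inertia_pow_le two_ne_zero)
  obtain ⟨h1, h2⟩ := ht.ord_sub_eq_two_and_modEq_of_trace_surjective (b := b)
    (fun σ hσ => (le_ord_unifL_sub_smul_iff ht hσ 2).2 σ.2)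
    (fun x hx hfix => h.exists_trace_eq_of_free _ hx hfix)
  rw [Nat.card_eq_fintype_card]
  refine ⟨(Subgroup.eq_bot_iff_forall _).2 fun σ hσ => ?_, h2⟩
  by_contra hne
  have hσ2 : σ ∈ (maximalIdeal B ^ 2).inertia G :=
    inertia_mono (Ideal.pow_le_pow_right (by norm_num)) hσ
  have hne' : (⟨σ, hσ2⟩ : (maximalIdeal B ^ 2).inertia G) ≠ 1 :=
    fun h => hne (congrArg Subtype.val h)
  have h3 := (le_ord_unifL_sub_smul_iff (L := L) ht hne' 3).2 hσ
  rw [h1 _ hne'] at h3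
  norm_num at h3

/-- The evaluation maps attached to a space of equivariant maps from a quotient of `M`. -/
theorem exists_isEquivariantEval {V E : Type*} [AddCommGroup V] [Module (ResidueField A) V]
    [Module (ResidueField A)[G] V] [IsScalarTower (ResidueField A) (ResidueField A)[G] V]
    [AddCommGroup E] [Module (ResidueField A) E]
    [Module (ResidueField A)[G] E] [IsScalarTower (ResidueField A) (ResidueField A)[G] E]
    {q : M →+ V} (hqs : Function.Surjective q) (hq : ∀ (a : A) m, q (a • m) = residue A a • q m)
    (hqG : ∀ (g : G) m, q (ρ g m) = single g (1 : ResidueField A) • q m) :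
    ∃ ev : (V →ₗ[(ResidueField A)[G]] E) →ₗ[ResidueField A] L → E,
      IsEquivariantEval (B := B)
        (Representation.ofModule' (k := ResidueField A) (G := G) E) b ev := by
  classical
  -- The value `0` outside the image of `ι` is arbitrary: `IsEquivariantEval` only constrains
  -- arguments in the `b`-th power.
  let ev : (V →ₗ[(ResidueField A)[G]] E) →ₗ[ResidueField A] L → E :=
    { toFun := fun f x => if hx : ∃ m, ι m = x then f (q hx.choose) else 0
      map_add' := fun f f' => by
        ext x
        by_cases hx : ∃ m, ι m = x
        · simp only [dif_pos hx, Pi.add_apply, LinearMap.add_apply]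
        · simp only [dif_neg hx, Pi.add_apply, add_zero]
      map_smul' := fun a f => by
        ext x
        by_cases hx : ∃ m, ι m = x
        · simp only [dif_pos hx, Pi.smul_apply, LinearMap.smul_apply, RingHom.id_apply]
        · simp only [dif_neg hx, Pi.smul_apply, smul_zero] }
  have hev : ∀ f m, ev f (ι m) = f (q m) := by
    intro f m
    have hx : ∃ m', ι m' = ι m := ⟨m, rfl⟩
    change (if hx : ∃ m', ι m' = ι m then f (q hx.choose) else 0) = _
    rw [dif_pos hx, h.injective hx.choose_spec]
  refine ⟨ev, ?_, ?_, ?_, ?_⟩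
  · intro f x hx y hy
    obtain ⟨m, rfl⟩ := (h.mem_iff x).1 hx
    obtain ⟨n, rfl⟩ := (h.mem_iff y).1 hy
    rw [← map_add, hev, hev, hev, map_add, map_add]
  · intro f a x hx
    obtain ⟨m, rfl⟩ := (h.mem_iff x).1 hx
    rw [← h.map_smul, hev, hev, hq, ← algebraMap_smul (ResidueField A)[G], LinearMap.map_smul,
      algebraMap_smul]
  · intro f g x hx
    obtain ⟨m, rfl⟩ := (h.mem_iff x).1 hx
    rw [← h.map_rho, hev, hev, hqG, LinearMap.map_smul]
    rfl
  · intro f hf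
    ext v
    obtain ⟨m, rfl⟩ := hqs v
    rw [← hev, hf _ (h.apply_mem m)]
    rfl

/-- The reduction of `M` is cyclic by the bound on maps to simple modules. A lift of its generator
then generates `M` freely. -/
theorem free_of_weaklyRamified [PerfectField (ResidueField A)] [Finite G] {p : ℕ} [Fact p.Prime]
    [CharP (ResidueField A) p] (h3 : (maximalIdeal B ^ 3).inertia G = ⊥)
    (hb : b ≡ 1 [ZMOD (Nat.card ((maximalIdeal B ^ 2).inertia G) : ℤ)]) :
    Module.Free A[G] ρ.asModule := by
  have := faithfulSMul_of_isGaloisGroup A B L G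
  obtain ⟨e⟩ := h.nonempty_linearEquiv
  have hfinM : Module.Finite A M := Module.Finite.equiv e
  have htf : Module.IsTorsionFree A B := by
    rw [Module.isTorsionFree_iff_faithfulSMul]; infer_instance
  have hfreeM : Module.Free A M := Module.Free.of_equiv e
  have hrank : finrank A M = Nat.card G := by
    rw [← e.finrank_eq, ← IsGaloisGroup.card_eq_finrank' G A B]
  have hcharB : CharP (ResidueField B) p :=
    charP_of_injective_algebraMap (algebraMap (ResidueField A) (ResidueField B)).injective p
  have hpB : (p : B) ∈ maximalIdeal B := by
    rw [← residue_eq_zero_iff, map_natCast, CharP.cast_eq_zero]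
  set H := (maximalIdeal B ^ 2).inertia G with hH
  have := Fintype.ofFinite H
  have hle : H ≤ (maximalIdeal B).inertia G := inertia_pow_le two_ne_zero
  have ht : IsTotallyRamified B L H := isTotallyRamified_of_le_inertia A B L H hle
  have hd : ∀ σ : H, σ ≠ 1 → ord B (unifL B L - σ • unifL B L) = 2 := by
    intro σ hσ
    refine le_antisymm ?_ ((le_ord_unifL_sub_smul_iff ht hσ 2).2 σ.2)
    by_contra! hlt
    have h4 : (σ : G) ∈ (maximalIdeal B ^ 3).inertia G :=
      (le_ord_unifL_sub_smul_iff (L := L) ht hσ 3).1 hlt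
    rw [h3, Subgroup.mem_bot] at h4
    exact hσ (Subtype.ext h4)
  have hpH : IsPGroup p H := ht.isPGroup_of_ord_sub_eq_two hpB hd
  have hδ := ht.ord_differentElement hd
  have hnormal : H.Normal := by
    refine ⟨fun σ hσ g x => ?_⟩
    have h4 : g • (σ • (g⁻¹ • x) - g⁻¹ • x) ∈ maximalIdeal B ^ 2 := by
      have h5 : σ • (g⁻¹ • x) - g⁻¹ • x ∈ maximalIdeal B ^ 2 := hσ (g⁻¹ • x)
      rw [← algebraMap_mem_powSubmodule (L := L)] at h5 ⊢
      rw [algebraMap.smul']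
      exact smul_mem_powSubmodule g h5
    rwa [smul_sub, smul_inv_smul, ← mul_smul, ← mul_smul] at h4
  obtain ⟨σ, hσ, u, t, hu, hcard, hinj⟩ := exists_mem_inertia_injOn (L := L)
    (fun x hx => card_dvd_ord A ((maximalIdeal B).inertia G) le_rfl hx) hpH
  have hgal := isGalois_residueField A B G
  obtain ⟨V, _, _, _, _, _, q, hqs, hq, hqG, hker⟩ := exists_reduction ρ
  have hfinΛ : Module.Finite (ResidueField A) (ResidueField A)[G] :=
    Module.Finite.equiv (coeffLinearEquiv (ResidueField A)).symm
  obtain ⟨v, hv⟩ := exists_span_singleton_eq_top_of_finrank_hom_le (k := ResidueField A)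
    (Λ := (ResidueField A)[G]) (V := V) (by
      intro E _ _ _ _ _ _
      obtain ⟨ev, hev⟩ := h.exists_isEquivariantEval (E := E) hqs hq hqG
      have hcH : (0 : ℕ) < Nat.card H := Nat.card_pos
      -- The element of `A` required here is a uniformizer. Its valuation in `B` is the order of
      -- inertia, that is `|H| t`.
      refine hev.finrank_le (exists_forall_residue_smul_eq A G) (m := Nat.card H) (t := t) hcH ?_
        ⟨unif A, ?_, ?_, ?_⟩ (residue_smul_of_mem_inertia hσ) hu (hinj b)
      · intro i hbi hi
        rw [Nat.card_eq_fintype_card] at hi hb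
        refine hev.vanishing_le_of_weaklyRamified (H := H) (fun τ => (τ : G)) (fun _ _ => rfl) ?_ ht
          hpH hpB hδ hb hbi hi
        intro τ
        ext e
        exact single_smul_eq_of_isPGroup H hpH τ.2 e
      · exact (irreducible_unif A).not_isUnit
      · rw [hcard]
        exact ord_algebraMap_unif A B L G
      · rw [Ne, IsFractionRing.to_map_eq_zero_iff, FaithfulSMul.algebraMap_eq_zero_iff]
        exact (irreducible_unif A).ne_zero)
  obtain ⟨x, rfl⟩ := hqs v
  have hfree' : Module.Free A ρ.asModule := hfreeM
  have hrank' : finrank A ρ.asModule = Nat.card G := hrank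
  refine free_of_span_sup_eq_top (M := ρ.asModule) (x := ρ.asModuleEquiv.symm x) hrank' ?_
  refine span_sup_eq_top_of_map (q.comp ρ.asModuleEquiv.toAddMonoidHom) ?_ ?_ ?_ hv
  · exact fun a m => hq a _
  · intro g m
    rw [Representation.single_smul, one_smul]
    exact hqG g _
  · exact fun m hm => (hker _).1 hm

end IsPowModel

end FreeLattice

end DVRExtension

/-! ### Application to the integral closure -/

section IntegralClosure

open IsLocalRing

variable (A K L : Type*) [CommRing A] [IsDomain A] [IsDiscreteValuationRing A]
  [IsAdicComplete (maximalIdeal A) A] [Field K] [Algebra A K] [IsFractionRing A K]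
  [Field L] [Algebra K L] [Algebra A L] [IsScalarTower A K L]
  [FiniteDimensional K L] [IsGalois K L]

theorem faithfulSMul_integralClosure (A K L : Type*) [CommRing A] [IsDomain A] [Field K]
    [Algebra A K] [IsFractionRing A K] [Field L] [Algebra K L] [Algebra A L]
    [IsScalarTower A K L] : FaithfulSMul A (integralClosure A L) := by
  rw [faithfulSMul_iff_algebraMap_injective]
  intro a b hab
  have h1 : algebraMap A L a = algebraMap A L b := congrArg Subtype.val hab
  rw [IsScalarTower.algebraMap_apply A K L, IsScalarTower.algebraMap_apply A K L] at h1
  exact IsFractionRing.injective A K (FaithfulSMul.algebraMap_injective K L h1)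

theorem isDiscreteValuationRing_integralClosure (A K L : Type*) [CommRing A] [IsDomain A]
    [IsDiscreteValuationRing A] [IsAdicComplete (maximalIdeal A) A] [Field K] [Algebra A K]
    [IsFractionRing A K] [Field L] [Algebra K L] [Algebra A L] [IsScalarTower A K L]
    [FiniteDimensional K L] [IsGalois K L] :
    IsDiscreteValuationRing (integralClosure A L) := by
  have := isLocalRing_integralClosure A K L
  have := integralClosure.isDedekindDomain A K L
  have := faithfulSMul_integralClosure A K L
  suffices hnf : ¬ IsField (integralClosure A L) by
    have h1 : IsDiscreteValuationRing (integralClosure A L) ↔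
        IsDedekindDomain (integralClosure A L) :=
      (IsDiscreteValuationRing.TFAE (integralClosure A L) hnf).out 0 2
    exact h1.2 inferInstance
  intro h
  have h1 : IsField A := isField_of_isIntegral_of_isField
    (FaithfulSMul.algebraMap_injective A (integralClosure A L)) h
  exact IsDiscreteValuationRing.not_isField A h1

theorem isGaloisGroup_integralClosure (A K L : Type*) [CommRing A] [IsDomain A]
    [IsIntegrallyClosed A] [Field K] [Algebra A K]
    [IsFractionRing A K] [Field L] [Algebra K L] [Algebra A L] [IsScalarTower A K L]
    [FiniteDimensional K L] [IsGalois K L] :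
    IsGaloisGroup (L ≃ₐ[K] L) A (integralClosure A L) where
  isInvariant := isInvariant_integralClosure A K L
  commutes := inferInstance
  faithful := by
    have : IsFractionRing (integralClosure A L) L :=
      integralClosure.isFractionRing_of_finite_extension K L
    refine ⟨fun {g g'} h => AlgEquiv.ext fun x => ?_⟩
    obtain ⟨y, z, hz, rfl⟩ := IsFractionRing.div_surjective (integralClosure A L) x
    rw [map_div₀, map_div₀]
    exact congrArg₂ _ (congrArg Subtype.val (h y)) (congrArg Subtype.val (h z))

theorem mem_fractionalIdealPow_iff [IsDiscreteValuationRing (integralClosure A L)]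
    [IsFractionRing (integralClosure A L) L] (b : ℤ) (x : L) :
    x ∈ fractionalIdealPow A K L b ↔ x ∈ DVRExtension.powSubmodule (integralClosure A L) L b := by
  have h1 : maximalIdealIntegers A K L =
      Ideal.span {DVRExtension.unif (integralClosure A L)} :=
    (DVRExtension.irreducible_unif (integralClosure A L)).maximalIdeal_eq
  have h2 : ∀ y : L, FractionalIdeal.spanSingleton (integralClosure A L)⁰ y ^ b =
      FractionalIdeal.spanSingleton (integralClosure A L)⁰ (y ^ b) := by
    intro y
    obtain ⟨n, rfl | rfl⟩ := b.eq_nat_or_neg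
    · rw [zpow_natCast, zpow_natCast, FractionalIdeal.spanSingleton_pow]
    · rw [zpow_neg, zpow_neg, zpow_natCast, zpow_natCast, FractionalIdeal.spanSingleton_pow,
        FractionalIdeal.spanSingleton_inv]
  unfold fractionalIdealPow
  rw [h1, FractionalIdeal.coeIdeal_span_singleton, h2,
    FractionalIdeal.mem_spanSingleton, DVRExtension.mem_powSubmodule]
  simp only [Algebra.smul_def, eq_comm]
  rfl

theorem isPowModel_fractionalIdealRep [IsDiscreteValuationRing (integralClosure A L)]
    [IsFractionRing (integralClosure A L) L] (b : ℤ) :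
    DVRExtension.IsPowModel (integralClosure A L) b (fractionalIdealRep A K L b)
      (Submodule.subtype _).toAddMonoidHom where
  injective := Subtype.val_injective
  mem_iff x := by
    rw [← mem_fractionalIdealPow_iff A K L]
    exact ⟨fun h => ⟨⟨x, h⟩, rfl⟩, by rintro ⟨m, rfl⟩; exact m.2⟩
  map_smul a m := Algebra.smul_def a (m : L)
  map_rho _ _ := rfl

end IntegralClosure

theorem mainTheorem2 (A K L : Type*) [CommRing A] [IsDomain A] [IsDiscreteValuationRing A]
    [IsAdicComplete (IsLocalRing.maximalIdeal A) A]
    (p : ℕ) [Fact p.Prime] [CharP (IsLocalRing.ResidueField A) p]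
    [PerfectField (IsLocalRing.ResidueField A)]
    [Field K] [Algebra A K] [IsFractionRing A K]
    [Field L] [Algebra K L] [Algebra A L] [IsScalarTower A K L]
    [FiniteDimensional K L] [IsGalois K L] (b : ℤ) :
    Module.Free A[L ≃ₐ[K] L] (fractionalIdealRep A K L b).asModule ↔
      IsWeaklyRamified A K L ∧ b ≡ 1 [ZMOD (Nat.card (ramificationGroup A K L 1) : ℤ)] := by
  have := isDiscreteValuationRing_integralClosure A K L
  have : IsFractionRing (integralClosure A L) L :=
    integralClosure.isFractionRing_of_finite_extension K L
  have : Module.Finite A (integralClosure A L) := IsIntegralClosure.finite A K L _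
  have := faithfulSMul_integralClosure A K L
  have := isGaloisGroup_integralClosure A K L
  have h := isPowModel_fractionalIdealRep A K L b
  -- The lower numbering is shifted by one: `G_1` and `G_2` are the inertia groups of the second and
  -- third powers of the maximal ideal.
  exact ⟨fun _ => h.weaklyRamified_of_free, fun ⟨h2, hb⟩ => h.free_of_weaklyRamified (p := p) h2 hb⟩
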